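/- **Setting.** Let $n\ge 0$, let $A$ be a (not necessarily unital) $C^*$-algebra with a strongly continuous action $\alpha$ of the torus $\mathbb T^n$ by $*$-automorphisms, and let $\theta\in M_n(\mathbb R)$ be skew-symmetric. *Spectral subspace assumption.* For a topological group $G$ acting on a $C^*$-algebra $B$ by $\beta$ and a continuous character $\chi:G\to U(1)$, put $B_\chi=\{b\in B:\beta_g(b)=\chi(g)b\ \text{for all } g\in G\}$, and let $B^G$ be the fixed point algebra. The action satisfies the *spectral subspace assumption* (SSA) if for every $\chi$ the norm closure $\overline{B_\chi B_\chi^*}$ of the linear span of $\{bc^*: b,c\in B_\chi\}$ is a complemented ideal of $B^G$, i.e. a closed two-sided ideal $I$ of $B^G$ for which there is a closed two-sided ideal $J$ with $B^G=I\oplus J$. *$\theta$-deformation.* Let $C(\mathbb T^n)_\theta$ be the noncommutative torus, i.e. the universal unital $C^*$-algebra generated by unitaries $U_1,\dots,U_n$ with $U_jU_k=e^{2\pi i\theta_{jk}}U_kU_j$, carrying the $\mathbb T^n$-action $t\cdot U_j=t_jU_j$, where $t=(t_1,\dots,t_n)$, $t_j\in U(1)$. Equip the spatial tensor product $A\otimes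 C(\mathbb T^n)_\theta$ with the diagonal action $t\cdot(a\otimes b)=\alpha_t(a)\otimes (t\cdot b)$. The $\theta$-deformation of $A$ is the fixed point algebra $A_\theta=(A\otimes C(\mathbb T^n)_\theta)^{\mathbb T^n}$, with the $\mathbb T^n$-action $\alpha^{(\theta)}$ that is the restriction of $a\otimes b\mapsto\alpha_t(a)\otimes b$. **Proposition.** $(A_\theta,\alpha^{(\theta)})$ satisfies the spectral subspace assumption if and only if $(A,\alpha)$ does. Moreover $a\mapsto a\otimes 1$ defines a $*$-isomorphism $\psi:A^{\mathbb T^n}\to A_\theta^{\mathbb T^n}$ onto the fixed point algebra of $\alpha^{(\theta)}$, and $\psi\big(\overline{A_\chi A_\chi^*}\big)=\overline{(A_\theta)_\chi(A_\theta)_\chi^*}$ for every character $\chi$ of $\mathbb T^n$. -/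

import Mathlib

set_option linter.unusedSectionVars false

open scoped TensorProduct

noncomputable section

universe u v w

/-! ## C*-seminorms and their completions -/

section CStarSeminorms

/-- A C*-seminorm on a complex `*`-algebra: a submultiplicative seminorm with the C*-property
(the equality `p (x⋆ x) = p x ^ 2` is `CStarSeminorm.apply_star_mul_self`). -/
structure CStarSeminorm (B : Type u) [NonUnitalRing B] [Module ℂ B] [StarRing B]
    extends Seminorm ℂ B where
  mul_le' : ∀ x y : B, toFun (x * y) ≤ toFun x * toFun y
  mul_self_le' : ∀ x : B, toFun x * toFun x ≤ toFun (star x * x)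

namespace CStarSeminorm

variable {B : Type u} [NonUnitalRing B] [Module ℂ B] [StarRing B]

instance : CoeFun (CStarSeminorm B) (fun _ => B → ℝ) := ⟨fun p => p.toFun⟩

theorem nonneg (p : CStarSeminorm B) (x : B) : 0 ≤ p x := apply_nonneg p.toSeminorm x

theorem add_le (p : CStarSeminorm B) (x y : B) : p (x + y) ≤ p x + p y := p.add_le' x y

theorem apply_smul (p : CStarSeminorm B) (c : ℂ) (x : B) : p (c • x) = ‖c‖ * p x := p.smul' c x

theorem apply_zero (p : CStarSeminorm B) : p 0 = 0 := map_zero p.toSeminorm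

theorem star_aux (p : CStarSeminorm B) (x : B) : p x ≤ p (star x) := by
  rcases (p.nonneg x).eq_or_lt with h | h
  · rw [← h]; exact p.nonneg _
  · exact le_of_mul_le_mul_right ((p.mul_self_le' x).trans (p.mul_le' _ _)) h

theorem apply_star (p : CStarSeminorm B) (x : B) : p (star x) = p x :=
  le_antisymm (by simpa using p.star_aux (star x)) (p.star_aux x)

theorem apply_star_mul_self (p : CStarSeminorm B) (x : B) : p (star x * x) = p x ^ 2 := by
  refine le_antisymm ((p.mul_le' _ _).trans_eq ?_) ?_
  · rw [p.apply_star, sq]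
  · rw [sq]; exact p.mul_self_le' x

/-- The pointwise supremum of a nonempty, pointwise bounded family of C*-seminorms. -/
def iSup {ι : Type v} [Nonempty ι] (q : ι → CStarSeminorm B)
    (hq : ∀ x, BddAbove (Set.range fun i => q i x)) : CStarSeminorm B where
  toFun x := ⨆ i, q i x
  map_zero' := by simp [apply_zero]
  add_le' x y := ciSup_le fun i => ((q i).add_le x y).trans
    (add_le_add (le_ciSup (hq x) i) (le_ciSup (hq y) i))
  neg' x := by
    congr 1; funext i; exact (q i).neg' x
  smul' c x := by
    simp only [apply_smul]
    rw [Real.mul_iSup_of_nonneg (norm_nonneg c)]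
  mul_le' x y := ciSup_le fun i => ((q i).mul_le' x y).trans
    (mul_le_mul (le_ciSup (hq x) i) (le_ciSup (hq y) i) ((q i).nonneg y)
      (((q i).nonneg x).trans (le_ciSup (hq x) i)))
  mul_self_le' x := by
    have h0 : 0 ≤ ⨆ i, q i (star x * x) := Real.iSup_nonneg fun i => (q i).nonneg _
    have h1 : 0 ≤ ⨆ i, q i x := Real.iSup_nonneg fun i => (q i).nonneg _
    have h2 : (⨆ i, q i x) ≤ √(⨆ i, q i (star x * x)) := ciSup_le fun i =>
      Real.le_sqrt_of_sq_le
        (((q i).apply_star_mul_self x).symm.le.trans (le_ciSup (hq (star x * x)) i))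
    calc (⨆ i, q i x) * (⨆ i, q i x)
        ≤ √(⨆ i, q i (star x * x)) * √(⨆ i, q i (star x * x)) :=
          mul_le_mul h2 h2 h1 (Real.sqrt_nonneg _)
      _ = _ := Real.mul_self_sqrt h0

/-- The C*-seminorm `x ↦ ‖f x‖` of a `*`-homomorphism into a C*-algebra. -/
def ofHom {D : Type v} [NonUnitalCStarAlgebra D] (f : B →⋆ₙₐ[ℂ] D) : CStarSeminorm B where
  toFun x := ‖f x‖
  map_zero' := by simp
  add_le' x y := by simpa using norm_add_le (f x) (f y)
  neg' x := by
    have : f (-x) = - f x := map_neg f x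
    rw [this, norm_neg]
  smul' c x := by simp [norm_smul]
  mul_le' x y := by simpa using norm_mul_le (f x) (f y)
  mul_self_le' x := by simp [map_star, CStarRing.norm_star_mul_self]

/-- A copy of `B`, carrying the topology of the C*-seminorm `p`. -/
def Carrier (_p : CStarSeminorm B) : Type u := B

variable (p : CStarSeminorm B)

instance : NonUnitalRing p.Carrier := inferInstanceAs (NonUnitalRing B)
instance : Module ℂ p.Carrier := inferInstanceAs (Module ℂ B)
instance : StarRing p.Carrier := inferInstanceAs (StarRing B)
instance [IsScalarTower ℂ B B] : IsScalarTower ℂ p.Carrier p.Carrier :=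
  inferInstanceAs (IsScalarTower ℂ B B)
instance [SMulCommClass ℂ B B] : SMulCommClass ℂ p.Carrier p.Carrier :=
  inferInstanceAs (SMulCommClass ℂ B B)
instance [StarModule ℂ B] : StarModule ℂ p.Carrier := inferInstanceAs (StarModule ℂ B)

instance : NonUnitalSeminormedRing p.Carrier where
  __ := AddGroupSeminorm.toSeminormedAddCommGroup (E := p.Carrier)
    { toFun := p.toFun
      map_zero' := p.map_zero'
      add_le' := p.add_le'
      neg' := p.neg' }
  __ := (inferInstance : NonUnitalRing p.Carrier)
  norm_mul_le := p.mul_le'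

instance : NormedSpace ℂ p.Carrier where
  norm_smul_le c x := (p.smul' c x).le

/-- The completion of (the separated quotient of) `B` with respect to the C*-seminorm `p`. -/
abbrev Completion : Type u := UniformSpace.Completion p.Carrier

namespace Completion

/-- The canonical map of `B` into its completion. -/
def of (x : B) : p.Completion := 
  UniformSpace.Completion.coe' (show p.Carrier from x)

theorem norm_of (x : B) : ‖of p x‖ = p x := UniformSpace.Completion.norm_coe (E := p.Carrier) x

theorem denseRange_of : DenseRange (of p) :=
  UniformSpace.Completion.denseRange_coe (α := p.Carrier)

theorem continuous_of : Continuous fun x : p.Carrier => of p x :=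
  UniformSpace.Completion.continuous_coe _

theorem of_add (x y : B) : of p (x + y) = of p x + of p y :=
  UniformSpace.Completion.coe_add (α := p.Carrier) x y

theorem of_zero : of p 0 = 0 := UniformSpace.Completion.coe_zero (α := p.Carrier)

theorem of_smul (c : ℂ) (x : B) : of p (c • x) = c • of p x :=
  UniformSpace.Completion.coe_smul (X := p.Carrier) c x

variable {p} in
theorem induction {P : p.Completion → Prop} (x : p.Completion)
    (hc : IsClosed {x | P x}) (h : ∀ x, P (of p x)) : P x :=
  isClosed_property (denseRange_of p) hc h x

instance : Mul p.Completion :=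
  ⟨Function.curry <| (UniformSpace.Completion.isDenseInducing_coe.prodMap
    UniformSpace.Completion.isDenseInducing_coe).extend
      (fun z : p.Carrier × p.Carrier => of p (z.1 * z.2))⟩

theorem of_mul (x y : B) : of p (x * y) = of p x * of p y :=
  ((UniformSpace.Completion.isDenseInducing_coe.prodMap
    UniformSpace.Completion.isDenseInducing_coe).extend_eq
      ((continuous_of p).comp (continuous_mul (M := p.Carrier))) (x, y)).symm

instance : ContinuousMul p.Completion where
  continuous_mul := by
    let m := (AddMonoidHom.mul : p.Carrier →+ p.Carrier →+ p.Carrier).compr₂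
      UniformSpace.Completion.toCompl
    have : Continuous fun z : p.Carrier × p.Carrier => m z.1 z.2 :=
      (continuous_of p).comp continuous_mul
    have di : IsDenseInducing (UniformSpace.Completion.toCompl : p.Carrier → _) :=
      UniformSpace.Completion.isDenseInducing_coe
    exact di.extend_Z_bilin di this

instance : Star p.Completion :=
  ⟨UniformSpace.Completion.map (fun x : p.Carrier => star x)⟩

theorem uniformContinuous_star : UniformContinuous fun x : p.Carrier => star x :=
  AddMonoidHomClass.uniformContinuous_of_bound (starAddEquiv : p.Carrier ≃+ p.Carrier) 1
    fun x => by rw [one_mul]; exact (p.apply_star x).le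

theorem of_star (x : B) : of p (star x) = star (of p x) :=
  (UniformSpace.Completion.map_coe (uniformContinuous_star p) x).symm

instance : ContinuousStar p.Completion where
  continuous_star := UniformSpace.Completion.continuous_map

theorem ind₂ {P : p.Completion → p.Completion → Prop} (x y : p.Completion)
    (hc : IsClosed {z : p.Completion × p.Completion | P z.1 z.2})
    (h : ∀ x y, P (of p x) (of p y)) : P x y :=
  UniformSpace.Completion.induction_on₂ (α := p.Carrier) (β := p.Carrier) x y hc h

theorem ind₃ {P : p.Completion → p.Completion → p.Completion → Prop} (x y z : p.Completion)
    (hc : IsClosed {z : p.Completion × p.Completion × p.Completion | P z.1 z.2.1 z.2.2})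
    (h : ∀ x y z, P (of p x) (of p y) (of p z)) : P x y z :=
  UniformSpace.Completion.induction_on₃ (α := p.Carrier) (β := p.Carrier) (γ := p.Carrier)
    x y z hc h

theorem zero_mul_aux (a : p.Completion) : 0 * a = 0 := by
  refine induction (P := fun a => 0 * a = 0) a (isClosed_eq (by fun_prop) (by fun_prop)) ?_
  intro a; rw [← of_zero, ← of_mul, zero_mul]

theorem mul_zero_aux (a : p.Completion) : a * 0 = 0 := by
  refine induction (P := fun a => a * 0 = 0) a (isClosed_eq (by fun_prop) (by fun_prop)) ?_
  intro a; rw [← of_zero, ← of_mul, mul_zero]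

theorem mul_assoc_aux (a b c : p.Completion) : a * b * c = a * (b * c) := by
  refine ind₃ p (P := fun a b c => a * b * c = a * (b * c)) a b c
    (isClosed_eq (by fun_prop) (by fun_prop)) ?_
  intro a b c; simp only [← of_mul, mul_assoc]

theorem mul_add_aux (a b c : p.Completion) : a * (b + c) = a * b + a * c := by
  refine ind₃ p (P := fun a b c => a * (b + c) = a * b + a * c) a b c
    (isClosed_eq (by fun_prop) (by fun_prop)) ?_
  intro a b c; simp only [← of_mul, ← of_add, mul_add]

theorem add_mul_aux (a b c : p.Completion) : (a + b) * c = a * c + b * c := by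
  refine ind₃ p (P := fun a b c => (a + b) * c = a * c + b * c) a b c
    (isClosed_eq (by fun_prop) (by fun_prop)) ?_
  intro a b c; simp only [← of_mul, ← of_add, add_mul]

theorem norm_mul_aux (a b : p.Completion) : ‖a * b‖ ≤ ‖a‖ * ‖b‖ := by
  refine ind₂ p (P := fun a b => ‖a * b‖ ≤ ‖a‖ * ‖b‖) a b
    (isClosed_le (by fun_prop) (by fun_prop)) ?_
  intro a b; simpa only [← of_mul, norm_of] using p.mul_le' a b

theorem star_star_aux (a : p.Completion) : star (star a) = a := by
  refine induction (P := fun a => star (star a) = a) a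
    (isClosed_eq (continuous_star.comp continuous_star) continuous_id) ?_
  intro a; simp only [← of_star, star_star]

theorem star_mul_aux (a b : p.Completion) : star (a * b) = star b * star a := by
  refine ind₂ p (P := fun a b => star (a * b) = star b * star a) a b
    (isClosed_eq (continuous_star.comp continuous_mul)
      ((continuous_star.comp continuous_snd).mul (continuous_star.comp continuous_fst))) ?_
  intro a b; simp only [← of_star, ← of_mul, star_mul]

theorem star_add_aux (a b : p.Completion) : star (a + b) = star a + star b := by
  refine ind₂ p (P := fun a b => star (a + b) = star a + star b) a b
    (isClosed_eq (continuous_star.comp continuous_add)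
      ((continuous_star.comp continuous_fst).add (continuous_star.comp continuous_snd))) ?_
  intro a b; simp only [← of_star, ← of_add, star_add]

theorem norm_mul_self_aux (a : p.Completion) : ‖a‖ * ‖a‖ ≤ ‖star a * a‖ := by
  refine induction (P := fun a => ‖a‖ * ‖a‖ ≤ ‖star a * a‖) a
    (isClosed_le (continuous_norm.mul continuous_norm) (continuous_star.mul continuous_id).norm) ?_
  intro a; simpa only [← of_star, ← of_mul, norm_of] using p.mul_self_le' a

theorem smul_mul_aux [IsScalarTower ℂ B B] (c : ℂ) (a b : p.Completion) :
    (c • a) * b = c • (a * b) := by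
  refine ind₂ p (P := fun a b => (c • a) * b = c • (a * b)) a b
    (isClosed_eq ((continuous_fst.const_smul c).mul continuous_snd) (continuous_mul.const_smul c)) ?_
  intro a b; simp only [← of_smul, ← of_mul, smul_mul_assoc]

theorem mul_smul_aux [SMulCommClass ℂ B B] (c : ℂ) (a b : p.Completion) :
    a * (c • b) = c • (a * b) := by
  refine ind₂ p (P := fun a b => a * (c • b) = c • (a * b)) a b
    (isClosed_eq (continuous_fst.mul (continuous_snd.const_smul c)) (continuous_mul.const_smul c)) ?_
  intro a b; simp only [← of_smul, ← of_mul, mul_smul_comm]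

theorem star_smul_aux [StarModule ℂ B] (c : ℂ) (a : p.Completion) :
    star (c • a) = star c • star a := by
  refine induction (P := fun a => star (c • a) = star c • star a) a
    (isClosed_eq (continuous_star.comp (continuous_const_smul c))
      ((continuous_const_smul (star c)).comp continuous_star)) ?_
  intro a; simp only [← of_smul, ← of_star, star_smul]

instance : NonUnitalNormedRing p.Completion where
  __ := (inferInstance : NormedAddCommGroup p.Completion)
  __ := (inferInstance : Mul p.Completion)
  zero_mul := zero_mul_aux p
  mul_zero := mul_zero_aux p
  mul_assoc := mul_assoc_aux p
  left_distrib := mul_add_aux p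
  right_distrib := add_mul_aux p
  norm_mul_le := norm_mul_aux p

instance : StarRing p.Completion where
  star_involutive := star_star_aux p
  star_mul := star_mul_aux p
  star_add := star_add_aux p

instance [IsScalarTower ℂ B B] [SMulCommClass ℂ B B] [StarModule ℂ B] :
    NonUnitalCStarAlgebra p.Completion where
  __ := (inferInstance : NonUnitalNormedRing p.Completion)
  __ := (inferInstance : StarRing p.Completion)
  __ := (inferInstance : NormedSpace ℂ p.Completion)
  __ := (inferInstance : CompleteSpace p.Completion)
  smul_assoc := smul_mul_aux p
  smul_comm c a b := (mul_smul_aux p c a b).symm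
  star_smul := star_smul_aux p
  norm_mul_self_le := norm_mul_self_aux p

section Lift

variable {D : Type v} [NonUnitalCStarAlgebra D] (f : B →⋆ₙₐ[ℂ] D)

def liftFun : p.Completion → D :=
  UniformSpace.Completion.extension (fun x : p.Carrier => f x)

theorem uc_aux (hf : ∀ x, ‖f x‖ ≤ p x) : UniformContinuous (fun x : p.Carrier => f x) :=
  AddMonoidHomClass.uniformContinuous_of_bound
    (AddMonoidHom.mk' (fun x : p.Carrier => f x) fun x y => map_add f x y) 1
    fun x => by rw [one_mul]; exact hf x

theorem continuous_liftFun : Continuous (liftFun p f) :=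
  UniformSpace.Completion.continuous_extension

variable [IsScalarTower ℂ B B] [SMulCommClass ℂ B B] [StarModule ℂ B]

/-- The canonical `*`-homomorphism of `B` into its completion. -/
def ofHom : B →⋆ₙₐ[ℂ] p.Completion where
  toFun := of p
  map_smul' := of_smul p
  map_zero' := of_zero p
  map_add' := of_add p
  map_mul' := of_mul p
  map_star' := of_star p

theorem liftFun_of (hf : ∀ x, ‖f x‖ ≤ p x) (x : B) : liftFun p f (of p x) = f x :=
  UniformSpace.Completion.extension_coe (uc_aux p f hf) x

/-- A `*`-homomorphism into a C*-algebra that is dominated by `p` extends to the completion. -/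
def lift (hf : ∀ x, ‖f x‖ ≤ p x) : p.Completion →⋆ₙₐ[ℂ] D where
  toFun := liftFun p f
  map_smul' c a := by
    have := continuous_liftFun p f
    refine induction (P := fun a => liftFun p f (c • a) = c • liftFun p f a) a
      (isClosed_eq (this.comp (continuous_const_smul c)) (this.const_smul c)) ?_
    intro a; simp only [← of_smul, liftFun_of p f hf, map_smul]
  map_zero' := by
    change liftFun p f 0 = 0
    rw [← of_zero, liftFun_of p f hf, map_zero]
  map_add' a b := by
    have := continuous_liftFun p f
    refine ind₂ p (P := fun a b => liftFun p f (a + b) = liftFun p f a + liftFun p f b) a b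
      (isClosed_eq (this.comp continuous_add)
        ((this.comp continuous_fst).add (this.comp continuous_snd))) ?_
    intro a b; simp only [← of_add, liftFun_of p f hf, map_add]
  map_mul' a b := by
    have := continuous_liftFun p f
    refine ind₂ p (P := fun a b => liftFun p f (a * b) = liftFun p f a * liftFun p f b) a b
      (isClosed_eq (this.comp continuous_mul)
        ((this.comp continuous_fst).mul (this.comp continuous_snd))) ?_
    intro a b; simp only [← of_mul, liftFun_of p f hf, map_mul]
  map_star' a := by
    have := continuous_liftFun p f
    refine induction (P := fun a => liftFun p f (star a) = star (liftFun p f a)) a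
      (isClosed_eq (this.comp continuous_star) (continuous_star.comp this)) ?_
    intro a; simp only [← of_star, liftFun_of p f hf, map_star]

@[simp] theorem lift_of (hf : ∀ x, ‖f x‖ ≤ p x) (x : B) : lift p f hf (of p x) = f x := liftFun_of p f hf x

end Lift

section Unital

variable {B : Type u} [Ring B] [Algebra ℂ B] [StarRing B] [StarModule ℂ B] (p : CStarSeminorm B)

theorem one_mul_aux (a : p.Completion) : of p 1 * a = a := by
  refine induction (P := fun a => of p 1 * a = a) a
    (isClosed_eq (continuous_const.mul continuous_id) continuous_id) ?_
  intro a; rw [← of_mul, one_mul]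

theorem mul_one_aux (a : p.Completion) : a * of p 1 = a := by
  refine induction (P := fun a => a * of p 1 = a) a
    (isClosed_eq (continuous_id.mul continuous_const) continuous_id) ?_
  intro a; rw [← of_mul, mul_one]

/-- The completion of a unital `*`-algebra is a unital ring, with unit the image of `1`. -/
abbrev normedRing : NormedRing p.Completion :=
  { (inferInstance : NonUnitalNormedRing p.Completion) with
    one := of p 1
    one_mul := one_mul_aux p
    mul_one := mul_one_aux p }

/-- The completion of a unital `*`-algebra is a unital C*-algebra, with unit the image of `1`. -/
abbrev cstarAlgebra : CStarAlgebra p.Completion :=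
  letI := normedRing p
  { (inferInstance : NonUnitalCStarAlgebra p.Completion), normedRing p with
    algebraMap :=
      { toFun := fun c => c • of p 1
        map_one' := one_smul ℂ _
        map_zero' := zero_smul ℂ _
        map_add' := fun c d => add_smul c d _
        map_mul' := fun c d => by
          rw [smul_mul_aux, mul_smul_aux, ← of_mul, one_mul, mul_smul] }
    commutes' := fun c x => by
      change (c • of p 1) * x = x * (c • of p 1)
      rw [smul_mul_aux, mul_smul_aux, one_mul_aux, mul_one_aux]
    smul_def' := fun c x => by
      change c • x = (c • of p 1) * x
      rw [smul_mul_aux, one_mul_aux] }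

end Unital

end Completion

end CStarSeminorm

end CStarSeminorms

/-! ## The spatial tensor product of two C*-algebras -/

section SpatialTensorProduct

/-- The tensor product of two Hilbert spaces. -/
def HilbertTensor (H : Type u) (K : Type v) [NormedAddCommGroup H] [InnerProductSpace ℂ H]
    [NormedAddCommGroup K] [InnerProductSpace ℂ K] : Type (max u v) :=
  UniformSpace.Completion (H ⊗[ℂ] K)

namespace HilbertTensor

variable {H : Type u} {K : Type v} [NormedAddCommGroup H] [InnerProductSpace ℂ H]
  [NormedAddCommGroup K] [InnerProductSpace ℂ K]

instance : NormedAddCommGroup (HilbertTensor H K) :=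
  inferInstanceAs (NormedAddCommGroup (UniformSpace.Completion (H ⊗[ℂ] K)))
instance : InnerProductSpace ℂ (HilbertTensor H K) :=
  inferInstanceAs (InnerProductSpace ℂ (UniformSpace.Completion (H ⊗[ℂ] K)))
instance : CompleteSpace (HilbertTensor H K) :=
  inferInstanceAs (CompleteSpace (UniformSpace.Completion (H ⊗[ℂ] K)))

/-- The inclusion of the algebraic tensor product. -/
def of : H ⊗[ℂ] K →ₗ[ℂ] HilbertTensor H K where
  toFun x := UniformSpace.Completion.coe' x
  map_add' x y := UniformSpace.Completion.coe_add x y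
  map_smul' c x := UniformSpace.Completion.coe_smul c x

theorem norm_of (x : H ⊗[ℂ] K) : ‖of x‖ = ‖x‖ := UniformSpace.Completion.norm_coe x

theorem inner_of (x y : H ⊗[ℂ] K) : inner ℂ (of x) (of y) = inner ℂ x y :=
  UniformSpace.Completion.inner_coe x y

theorem denseRange_of : DenseRange (of : H ⊗[ℂ] K → HilbertTensor H K) :=
  UniformSpace.Completion.denseRange_coe

theorem ext_clm {E : Type w} [NormedAddCommGroup E] [NormedSpace ℂ E]
    {S T : HilbertTensor H K →L[ℂ] E}
    (h : ∀ (x : H) (y : K), S (of (x ⊗ₜ[ℂ] y)) = T (of (x ⊗ₜ[ℂ] y))) : S = T := by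
  refine ContinuousLinearMap.ext fun z =>
    congrFun (denseRange_of.equalizer S.continuous T.continuous ?_) z
  funext e
  change S (of e) = T (of e)
  induction e using TensorProduct.induction_on with
  | zero => simp
  | add e f he hf => rw [map_add, map_add, map_add, he, hf]
  | tmul x y => exact h x y

/-- The tensor product `S ⊗ T` of two bounded operators. -/
def mapL (S : H →L[ℂ] H) (T : K →L[ℂ] K) : HilbertTensor H K →L[ℂ] HilbertTensor H K :=
  (TensorProduct.mapL S T).completion

theorem mapL_of (S : H →L[ℂ] H) (T : K →L[ℂ] K) (e : H ⊗[ℂ] K) :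
    mapL S T (of e) = of (TensorProduct.mapL S T e) :=
  ContinuousLinearMap.completion_apply_coe (TensorProduct.mapL S T) e

@[simp] theorem mapL_tmul (S : H →L[ℂ] H) (T : K →L[ℂ] K) (x : H) (y : K) :
    mapL S T (of (x ⊗ₜ[ℂ] y)) = of (S x ⊗ₜ[ℂ] T y) := mapL_of S T _

theorem norm_mapL_le (S : H →L[ℂ] H) (T : K →L[ℂ] K) : ‖mapL S T‖ ≤ ‖S‖ * ‖T‖ := by
  refine ContinuousLinearMap.opNorm_le_bound _ (by positivity) fun z => ?_
  refine denseRange_of.induction_on z (isClosed_le (by fun_prop) (by fun_prop)) fun e => ?_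
  rw [mapL_of, norm_of, norm_of]
  exact ContinuousLinearMap.le_of_opNorm_le _ (TensorProduct.norm_mapL_le S T) e

theorem adjoint_mapL [CompleteSpace H] [CompleteSpace K] (S : H →L[ℂ] H) (T : K →L[ℂ] K) :
    star (mapL S T) = mapL (star S) (star T) := by
  refine ext_clm fun x y => ?_
  refine denseRange_of.eq_of_inner_right ℂ fun f => ?_
  induction f using TensorProduct.induction_on with
  | zero => simp
  | add e f he hf => rw [map_add, inner_add_left, inner_add_left, he, hf]
  | tmul x' y' =>
    rw [ContinuousLinearMap.star_eq_adjoint, ContinuousLinearMap.adjoint_inner_right, mapL_tmul,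
      mapL_tmul, inner_of, inner_of, TensorProduct.inner_tmul, TensorProduct.inner_tmul,
      ContinuousLinearMap.star_eq_adjoint, ContinuousLinearMap.star_eq_adjoint,
      ContinuousLinearMap.adjoint_inner_right, ContinuousLinearMap.adjoint_inner_right]

end HilbertTensor

/-- A `*`-representation of the C*-algebra `A` on a Hilbert space. -/
structure HilbertRep (A : Type u) [NonUnitalCStarAlgebra A] where
  /-- the Hilbert space -/
  H : Type u
  [normedAddCommGroup : NormedAddCommGroup H]
  [innerProductSpace : InnerProductSpace ℂ H]
  [completeSpace : CompleteSpace H]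
  /-- the representation -/
  π : A →⋆ₙₐ[ℂ] (H →L[ℂ] H)

attribute [instance] HilbertRep.normedAddCommGroup HilbertRep.innerProductSpace
  HilbertRep.completeSpace

variable {A : Type u} [NonUnitalCStarAlgebra A] {N : Type v} [NonUnitalCStarAlgebra N]

namespace HilbertRep

instance : Nonempty (HilbertRep A) :=
  ⟨{ H := EuclideanSpace ℂ (ULift.{u} (Fin 1)), π := 0 }⟩

/-- The representation `π ∘ f`. -/
def comp {A' : Type u} [NonUnitalCStarAlgebra A'] (ρ : HilbertRep A) (f : A' →⋆ₙₐ[ℂ] A) :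
    HilbertRep A' where
  H := ρ.H
  π := ρ.π.comp f

/-- The representation `π ⊗ σ` of the algebraic tensor product on the tensor product of the two
Hilbert spaces: `(π ⊗ σ)(a ⊗ b) = π a ⊗ σ b`. -/
def tensor (ρ : HilbertRep A) (σ : HilbertRep N) :
    A ⊗[ℂ] N →⋆ₙₐ[ℂ] (HilbertTensor ρ.H σ.H →L[ℂ] HilbertTensor ρ.H σ.H) :=
  let L : A ⊗[ℂ] N →ₗ[ℂ] (HilbertTensor ρ.H σ.H →L[ℂ] HilbertTensor ρ.H σ.H) :=
    TensorProduct.lift (LinearMap.mk₂ ℂ (fun a b => HilbertTensor.mapL (ρ.π a) (σ.π b))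
      (fun a a' b => HilbertTensor.ext_clm fun x y => by simp [TensorProduct.add_tmul])
      (fun c a b => HilbertTensor.ext_clm fun x y => by simp [← TensorProduct.smul_tmul'])
      (fun a b b' => HilbertTensor.ext_clm fun x y => by simp [TensorProduct.tmul_add])
      (fun c a b => HilbertTensor.ext_clm fun x y => by simp))
  have hL : ∀ a b, L (a ⊗ₜ b) = HilbertTensor.mapL (ρ.π a) (σ.π b) := fun _ _ => rfl
  { toFun := L
    map_smul' := fun c x => map_smul L c x
    map_zero' := map_zero L
    map_add' := map_add L
    map_mul' := fun x y => by
      induction x using TensorProduct.induction_on with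
      | zero => simp
      | add x x' hx hx' => rw [add_mul, map_add, hx, hx', map_add, add_mul]
      | tmul a b =>
        induction y using TensorProduct.induction_on with
        | zero => simp
        | add y y' hy hy' => rw [mul_add, map_add, hy, hy', map_add, mul_add]
        | tmul c d =>
          rw [Algebra.TensorProduct.tmul_mul_tmul, hL, hL, hL]
          exact HilbertTensor.ext_clm fun x y => by simp
    map_star' := fun x => by
      induction x using TensorProduct.induction_on with
      | zero => simp
      | add x x' hx hx' => rw [star_add, map_add, hx, hx', map_add, star_add]
      | tmul a b =>
        rw [TensorProduct.star_tmul, hL, hL, map_star, map_star, HilbertTensor.adjoint_mapL] }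

variable (ρ : HilbertRep A) (σ : HilbertRep N)

theorem tensor_tmul (a : A) (b : N) :
    ρ.tensor σ (a ⊗ₜ[ℂ] b) = HilbertTensor.mapL (ρ.π a) (σ.π b) := rfl

/-- The C*-seminorm `x ↦ ‖(π ⊗ σ) x‖` on the algebraic tensor product. -/
def tensorSeminorm : CStarSeminorm (A ⊗[ℂ] N) := CStarSeminorm.ofHom (ρ.tensor σ)

theorem tensorSeminorm_tmul_le (a : A) (b : N) :
    ρ.tensorSeminorm σ (a ⊗ₜ[ℂ] b) ≤ ‖a‖ * ‖b‖ :=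
  (HilbertTensor.norm_mapL_le _ _).trans
    (mul_le_mul (NonUnitalStarAlgHom.norm_apply_le ρ.π a)
      (NonUnitalStarAlgHom.norm_apply_le σ.π b) (norm_nonneg _) (norm_nonneg _))

theorem bddAbove_tensorSeminorm (x : A ⊗[ℂ] N) :
    BddAbove (Set.range fun i : HilbertRep A × HilbertRep N => i.1.tensorSeminorm i.2 x) := by
  suffices h : ∃ C : ℝ, ∀ i : HilbertRep A × HilbertRep N, i.1.tensorSeminorm i.2 x ≤ C by
    obtain ⟨C, hC⟩ := h
    exact ⟨C, by rintro _ ⟨i, rfl⟩; exact hC i⟩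
  induction x using TensorProduct.induction_on with
  | zero => exact ⟨0, fun i => (i.1.tensorSeminorm i.2).apply_zero.le⟩
  | add x y hx hy =>
    obtain ⟨C, hC⟩ := hx
    obtain ⟨D, hD⟩ := hy
    exact ⟨C + D, fun i => ((i.1.tensorSeminorm i.2).add_le x y).trans (add_le_add (hC i) (hD i))⟩
  | tmul a b => exact ⟨‖a‖ * ‖b‖, fun i => i.1.tensorSeminorm_tmul_le i.2 a b⟩

end HilbertRep

variable (A N) in
/-- The spatial (minimal) C*-norm on the algebraic tensor product:
the supremum of `‖(π ⊗ σ) x‖` over all pairs of Hilbert space representations. -/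
def spatialNorm : CStarSeminorm (A ⊗[ℂ] N) :=
  CStarSeminorm.iSup (fun i : HilbertRep A × HilbertRep N => i.1.tensorSeminorm i.2)
    HilbertRep.bddAbove_tensorSeminorm

variable (A N) in
/-- The spatial tensor product of two C*-algebras. -/
def SpatialTensor : Type (max u v) := (spatialNorm A N).Completion

namespace SpatialTensor

instance : NonUnitalCStarAlgebra (SpatialTensor A N) :=
  inferInstanceAs (NonUnitalCStarAlgebra (spatialNorm A N).Completion)

variable (A N) in
/-- The canonical map of the algebraic tensor product into the spatial tensor product. -/
def of : A ⊗[ℂ] N →⋆ₙₐ[ℂ] SpatialTensor A N := CStarSeminorm.Completion.ofHom (spatialNorm A N)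

theorem norm_of (x : A ⊗[ℂ] N) : ‖of A N x‖ = spatialNorm A N x :=
  CStarSeminorm.Completion.norm_of _ x

theorem denseRange_of : DenseRange (of A N) :=
  CStarSeminorm.Completion.denseRange_of (spatialNorm A N)

/-- The elementary tensor `a ⊗ b` in the spatial tensor product. -/
def tmul (a : A) (b : N) : SpatialTensor A N := of A N (a ⊗ₜ[ℂ] b)

theorem norm_tmul_le (a : A) (b : N) : ‖tmul a b‖ ≤ ‖a‖ * ‖b‖ :=
  (norm_of (a ⊗ₜ[ℂ] b)).trans_le (ciSup_le fun i => i.1.tensorSeminorm_tmul_le i.2 a b)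

theorem continuous_tmul : Continuous fun z : A × N => tmul z.1 z.2 := by
  let m : A →ₗ[ℂ] N →ₗ[ℂ] SpatialTensor A N := LinearMap.mk₂ ℂ (fun a b => tmul a b)
    (fun a a' b => by simp [tmul, TensorProduct.add_tmul])
    (fun c a b => by simp [tmul, ← TensorProduct.smul_tmul'])
    (fun a b b' => by simp [tmul, TensorProduct.tmul_add])
    (fun c a b => by simp [tmul])
  have : ∀ z : A × N, tmul z.1 z.2 =
      m.mkContinuous₂ 1 (fun a b => by rw [one_mul]; exact norm_tmul_le a b) z.1 z.2 := fun z => rfl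
  simp only [this]
  fun_prop

open scoped CStarAlgebra in
/-- Two `*`-homomorphisms on the spatial tensor product agree if they agree on all `a ⊗ b`. -/
theorem hom_ext {D : Type w} [NonUnitalCStarAlgebra D] {f g : SpatialTensor A N →⋆ₙₐ[ℂ] D}
    (h : ∀ a b, f (tmul a b) = g (tmul a b)) : f = g := by
  have hf : Continuous f := map_continuous f
  have hg : Continuous g := map_continuous g
  refine NonUnitalStarAlgHom.ext fun x => congrFun (denseRange_of.equalizer hf hg ?_) x
  funext x
  change f (of A N x) = g (of A N x)
  induction x using TensorProduct.induction_on with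
  | zero => simp
  | add x y hx hy => simp only [map_add, hx, hy]
  | tmul a b => exact h a b

/-- The `*`-homomorphism `f ⊗ g` on the algebraic tensor product. -/
def algMap {A' : Type u} [NonUnitalCStarAlgebra A'] {N' : Type v} [NonUnitalCStarAlgebra N']
    (f : A →⋆ₙₐ[ℂ] A') (g : N →⋆ₙₐ[ℂ] N') : A ⊗[ℂ] N →⋆ₙₐ[ℂ] A' ⊗[ℂ] N' where
  toFun := TensorProduct.map (f : A →ₗ[ℂ] A') (g : N →ₗ[ℂ] N')
  map_smul' c x := map_smul _ c x
  map_zero' := map_zero _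
  map_add' := map_add _
  map_mul' x y := by
    induction x using TensorProduct.induction_on with
    | zero => simp
    | add x x' hx hx' => rw [add_mul, map_add, hx, hx', map_add, add_mul]
    | tmul a b =>
      induction y using TensorProduct.induction_on with
      | zero => simp
      | add y y' hy hy' => rw [mul_add, map_add, hy, hy', map_add, mul_add]
      | tmul c d => simp
  map_star' x := by
    induction x using TensorProduct.induction_on with
    | zero => simp
    | add x x' hx hx' => rw [star_add, map_add, hx, hx', map_add, star_add]
    | tmul a b => simp [map_star]

section Map

variable {A' : Type u} [NonUnitalCStarAlgebra A'] {N' : Type v} [NonUnitalCStarAlgebra N']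
    (f : A →⋆ₙₐ[ℂ] A') (g : N →⋆ₙₐ[ℂ] N')

theorem tensor_algMap (ρ : HilbertRep A') (σ : HilbertRep N') (x : A ⊗[ℂ] N) :
    ρ.tensor σ (algMap f g x) = (ρ.comp f).tensor (σ.comp g) x := by
  induction x using TensorProduct.induction_on with
  | zero => rw [map_zero, map_zero, map_zero]; rfl
  | add x y hx hy => rw [map_add, map_add, map_add, hx, hy]; rfl
  | tmul a b => rfl

theorem norm_algMap_le (x : A ⊗[ℂ] N) : ‖of A' N' (algMap f g x)‖ ≤ spatialNorm A N x := by
  rw [norm_of]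
  refine ciSup_le fun i => ?_
  refine le_trans (le_of_eq ?_)
    (le_ciSup (HilbertRep.bddAbove_tensorSeminorm x) (i.1.comp f, i.2.comp g))
  exact congrArg norm (tensor_algMap f g i.1 i.2 x)

/-- The `*`-homomorphism `f ⊗ g` of spatial tensor products. -/
def map : SpatialTensor A N →⋆ₙₐ[ℂ] SpatialTensor A' N' :=
  CStarSeminorm.Completion.lift (spatialNorm A N) ((of A' N').comp (algMap f g))
    (norm_algMap_le f g)

@[simp] theorem map_tmul (a : A) (b : N) : map f g (tmul a b) = tmul (f a) (g b) :=
  CStarSeminorm.Completion.lift_of (spatialNorm A N) _ (norm_algMap_le f g) (a ⊗ₜ[ℂ] b)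

end Map

end SpatialTensor

end SpatialTensorProduct

/-! ## The noncommutative torus -/

section NoncommutativeTorus

namespace GroupAlgebra

variable {G : Type u} [Group G]

/-- The involution `(∑ c_g g)⋆ = ∑ conj(c_g) g⁻¹` of the complex group algebra. -/
instance : Star (MonoidAlgebra ℂ G) :=
  ⟨fun x => x.coeff.sum fun g c => MonoidAlgebra.single g⁻¹ (star c)⟩

theorem star_single (g : G) (c : ℂ) :
    star (MonoidAlgebra.single g c) = MonoidAlgebra.single g⁻¹ (star c) := by
  change Finsupp.sum _ _ = _
  rw [MonoidAlgebra.coeff_single, Finsupp.sum_single_index (by simp)]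

theorem star_zero_aux : star (0 : MonoidAlgebra ℂ G) = 0 := by
  change Finsupp.sum _ _ = _
  simp

theorem star_add_aux (x y : MonoidAlgebra ℂ G) : star (x + y) = star x + star y := by
  change Finsupp.sum _ _ = Finsupp.sum _ _ + Finsupp.sum _ _
  rw [MonoidAlgebra.coeff_add, Finsupp.sum_add_index' (by simp) (by simp)]

instance : StarRing (MonoidAlgebra ℂ G) where
  star_add := star_add_aux
  star_involutive x := by
    induction x using MonoidAlgebra.induction_linear with
    | zero => rw [star_zero_aux, star_zero_aux]
    | add x y hx hy => rw [star_add_aux, star_add_aux, hx, hy]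
    | single g c => simp [star_single]
  star_mul x y := by
    induction x using MonoidAlgebra.induction_linear with
    | zero => rw [zero_mul, star_zero_aux, mul_zero]
    | add x x' hx hx' => rw [add_mul, star_add_aux, star_add_aux, mul_add, hx, hx']
    | single g c =>
      induction y using MonoidAlgebra.induction_linear with
      | zero => rw [mul_zero, star_zero_aux, zero_mul]
      | add y y' hy hy' => rw [mul_add, star_add_aux, star_add_aux, add_mul, hy, hy']
      | single h d => simp [star_single, mul_comm]

instance : StarModule ℂ (MonoidAlgebra ℂ G) where
  star_smul c x := by
    induction x using MonoidAlgebra.induction_linear with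
    | zero => simp
    | add x y hx hy => rw [smul_add, star_add, star_add, smul_add, hx, hy]
    | single g d => simp [star_single]

/-- Every C*-seminorm on a group algebra is at most `1` on the group. -/
theorem seminorm_single_le (p : CStarSeminorm (MonoidAlgebra ℂ G)) (g : G) :
    p (MonoidAlgebra.single g 1) ≤ 1 := by
  have h : ∀ g : G, p (MonoidAlgebra.single g 1) ^ 2 = p 1 := fun g => by
    rw [← p.apply_star_mul_self, star_single, MonoidAlgebra.single_mul_single,
      MonoidAlgebra.one_def]
    simp
  have h1 : p (MonoidAlgebra.single 1 1) ^ 2 = p (MonoidAlgebra.single 1 1) := h 1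
  have h2 := h g
  rw [MonoidAlgebra.one_def] at h2
  have h3 : p (MonoidAlgebra.single 1 1) ≤ 1 := by
    by_contra h; nlinarith
  nlinarith

/-- The `*`-homomorphism on the group algebra given by a unitary representation of the group. -/
def liftUnitary {D : Type v} [CStarAlgebra D] (V : G →* unitary D) :
    MonoidAlgebra ℂ G →⋆ₐ[ℂ] D :=
  { MonoidAlgebra.lift ℂ D G ((unitary D).subtype.comp V) with
    map_star' := fun x => by
      change MonoidAlgebra.lift ℂ D G ((unitary D).subtype.comp V) _ =
        star (MonoidAlgebra.lift ℂ D G ((unitary D).subtype.comp V) _)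
      induction x using MonoidAlgebra.induction_linear with
      | zero => simp
      | add x y hx hy => rw [star_add, map_add, hx, hy, map_add, star_add]
      | single g c =>
        rw [star_single, MonoidAlgebra.lift_single, MonoidAlgebra.lift_single, star_smul]
        simp [← Unitary.star_eq_inv] }

theorem liftUnitary_single {D : Type v} [CStarAlgebra D] (V : G →* unitary D) (g : G) (c : ℂ) :
    liftUnitary V (MonoidAlgebra.single g c) = c • (V g : D) :=
  MonoidAlgebra.lift_single ((unitary D).subtype.comp V) g c

end GroupAlgebra

variable {n : ℕ}

/-- The relations `V_j V_k = e^{2πi θ_jk} V_k V_j` of the noncommutative torus. -/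
def TorusRelations {D : Type v} [Mul D] [SMul ℂ D] (θ : Matrix (Fin n) (Fin n) ℝ)
    (V : Fin n → D) : Prop :=
  ∀ j k, V j * V k = Complex.exp (2 * Real.pi * Complex.I * θ j k) • (V k * V j)

/-- The generators of the complex group algebra of the free group on `n` letters, that is, of the
universal unital `*`-algebra generated by `n` unitaries. -/
def freeUnitary (j : Fin n) : MonoidAlgebra ℂ (FreeGroup (Fin n)) :=
  MonoidAlgebra.single (FreeGroup.of j) 1

/-- The C*-seminorms on the universal `*`-algebra generated by `n` unitaries for which the
relations of the noncommutative torus hold. -/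
def TorusSeminorm (θ : Matrix (Fin n) (Fin n) ℝ) : Type :=
  {p : CStarSeminorm (MonoidAlgebra ℂ (FreeGroup (Fin n))) //
    ∀ j k, p (freeUnitary j * freeUnitary k -
      Complex.exp (2 * Real.pi * Complex.I * θ j k) • (freeUnitary k * freeUnitary j)) = 0}

variable (θ : Matrix (Fin n) (Fin n) ℝ)

instance : Nonempty (TorusSeminorm θ) :=
  ⟨⟨{ toSeminorm := 0
      mul_le' := fun _ _ => (mul_zero (0 : ℝ)).ge
      mul_self_le' := fun _ => (mul_zero (0 : ℝ)).le }, fun _ _ => rfl⟩⟩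

theorem bddAbove_torusSeminorm (x : MonoidAlgebra ℂ (FreeGroup (Fin n))) :
    BddAbove (Set.range fun p : TorusSeminorm θ => p.1 x) := by
  suffices h : ∃ C : ℝ, ∀ p : TorusSeminorm θ, p.1 x ≤ C by
    obtain ⟨C, hC⟩ := h
    exact ⟨C, by rintro _ ⟨i, rfl⟩; exact hC i⟩
  induction x using MonoidAlgebra.induction_linear with
  | zero => exact ⟨0, fun p => p.1.apply_zero.le⟩
  | add x y hx hy =>
    obtain ⟨C, hC⟩ := hx
    obtain ⟨D, hD⟩ := hy
    exact ⟨C + D, fun p => (p.1.add_le x y).trans (add_le_add (hC p) (hD p))⟩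
  | single g c =>
    refine ⟨‖c‖, fun p => ?_⟩
    have : MonoidAlgebra.single g c = c • MonoidAlgebra.single g (1 : ℂ) := by simp
    rw [this, p.1.apply_smul]
    exact mul_le_of_le_one_right (norm_nonneg c) (GroupAlgebra.seminorm_single_le p.1 g)

/-- The universal C*-seminorm for the relations of the noncommutative torus. -/
def torusNorm : CStarSeminorm (MonoidAlgebra ℂ (FreeGroup (Fin n))) :=
  CStarSeminorm.iSup (fun p : TorusSeminorm θ => p.1) (bddAbove_torusSeminorm θ)

/-- The noncommutative torus: the universal C*-algebra generated by `n` unitaries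
`U_1, …, U_n` subject to the relations `U_j U_k = e^{2πi θ_jk} U_k U_j`. Its universal property is
given by `NCTorus.lift` and `NCTorus.hom_ext`. -/
def NCTorus : Type := (torusNorm θ).Completion

namespace NCTorus

instance : CStarAlgebra (NCTorus θ) :=
  letI := CStarSeminorm.Completion.cstarAlgebra (torusNorm θ)
  inferInstanceAs (CStarAlgebra (torusNorm θ).Completion)

/-- The canonical map of the universal `*`-algebra generated by `n` unitaries. -/
def of : MonoidAlgebra ℂ (FreeGroup (Fin n)) →⋆ₐ[ℂ] NCTorus θ where
  toFun := CStarSeminorm.Completion.of (torusNorm θ)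
  map_one' := rfl
  map_mul' := CStarSeminorm.Completion.of_mul (torusNorm θ)
  map_zero' := CStarSeminorm.Completion.of_zero (torusNorm θ)
  map_add' := CStarSeminorm.Completion.of_add (torusNorm θ)
  commutes' c := by
    rw [Algebra.algebraMap_eq_smul_one]
    exact CStarSeminorm.Completion.of_smul (torusNorm θ) c 1
  map_star' := CStarSeminorm.Completion.of_star (torusNorm θ)

theorem norm_of (x : MonoidAlgebra ℂ (FreeGroup (Fin n))) : ‖of θ x‖ = torusNorm θ x :=
  CStarSeminorm.Completion.norm_of _ x

theorem denseRange_of : DenseRange (of θ) :=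
  CStarSeminorm.Completion.denseRange_of (torusNorm θ)

/-- The generators `U_1, …, U_n` of the noncommutative torus. -/
def U (j : Fin n) : NCTorus θ := of θ (freeUnitary j)

theorem U_mem_unitary (j : Fin n) : U θ j ∈ unitary (NCTorus θ) := by
  rw [Unitary.mem_iff, U, ← map_star, ← map_mul, ← map_mul, freeUnitary,
    GroupAlgebra.star_single, MonoidAlgebra.single_mul_single, MonoidAlgebra.single_mul_single]
  simp [← MonoidAlgebra.one_def]

theorem torusRelations_U : TorusRelations θ (U θ) := fun j k => by
  rw [← sub_eq_zero, U, U, ← map_mul, ← map_mul, ← map_smul, ← map_sub, ← norm_eq_zero, norm_of]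
  change (⨆ p : TorusSeminorm θ, p.1 _) = 0
  simp only [fun p : TorusSeminorm θ => p.2 j k]
  exact Real.iSup_const_zero

section Lift

variable {θ} {D : Type v} [CStarAlgebra D] (V : Fin n → D) (hV : ∀ j, V j ∈ unitary D)

def preLift : MonoidAlgebra ℂ (FreeGroup (Fin n)) →⋆ₐ[ℂ] D :=
  GroupAlgebra.liftUnitary (FreeGroup.lift fun j => (⟨V j, hV j⟩ : unitary D))

theorem preLift_freeUnitary (j : Fin n) : preLift V hV (freeUnitary j) = V j := by
  rw [preLift, freeUnitary, GroupAlgebra.liftUnitary_single]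
  simp

theorem norm_preLift_le (hrel : TorusRelations θ V) (x : MonoidAlgebra ℂ (FreeGroup (Fin n))) :
    ‖preLift V hV x‖ ≤ torusNorm θ x := by
  refine le_ciSup (f := fun p : TorusSeminorm θ => p.1 x) (bddAbove_torusSeminorm θ x)
    ⟨CStarSeminorm.ofHom (preLift V hV : _ →⋆ₙₐ[ℂ] D), fun j k => ?_⟩
  change ‖preLift V hV _‖ = 0
  rw [map_sub, map_smul, map_mul, map_mul, preLift_freeUnitary, preLift_freeUnitary, hrel j k,
    sub_self, norm_zero]

def lift₀ (hrel : TorusRelations θ V) : NCTorus θ →⋆ₙₐ[ℂ] D :=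
  CStarSeminorm.Completion.lift (torusNorm θ) (preLift V hV : _ →⋆ₙₐ[ℂ] D)
    (norm_preLift_le V hV hrel)

theorem lift₀_of (hrel : TorusRelations θ V) (x : MonoidAlgebra ℂ (FreeGroup (Fin n))) :
    lift₀ V hV hrel (of θ x) = preLift V hV x :=
  CStarSeminorm.Completion.lift_of (torusNorm θ) _ (norm_preLift_le V hV hrel) x

theorem lift₀_one (hrel : TorusRelations θ V) : lift₀ V hV hrel 1 = 1 := by
  rw [← map_one (of θ), lift₀_of, map_one]

/-- The universal property of the noncommutative torus: existence. -/
def lift (hrel : TorusRelations θ V) : NCTorus θ →⋆ₐ[ℂ] D where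
  toFun := lift₀ V hV hrel
  map_one' := lift₀_one V hV hrel
  map_mul' := map_mul _
  map_zero' := map_zero _
  map_add' := map_add _
  commutes' c := by
    rw [Algebra.algebraMap_eq_smul_one, Algebra.algebraMap_eq_smul_one, map_smul, lift₀_one]
  map_star' := map_star _

@[simp] theorem lift_U (hrel : TorusRelations θ V) (j : Fin n) : lift V hV hrel (U θ j) = V j :=
  (lift₀_of V hV hrel _).trans (preLift_freeUnitary V hV j)

open scoped CStarAlgebra in
variable {V} in
/-- The universal property of the noncommutative torus: uniqueness. -/
theorem hom_ext {f g : NCTorus θ →⋆ₐ[ℂ] D} (h : ∀ j, f (U θ j) = g (U θ j)) : f = g := by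
  have hf : Continuous f := map_continuous f
  have hg : Continuous g := map_continuous g
  refine StarAlgHom.ext fun x => congrFun ((denseRange_of θ).equalizer hf hg ?_) x
  have key : (f.comp (of θ)).toAlgHom = (g.comp (of θ)).toAlgHom := by
    refine MonoidAlgebra.algHom_ext' ?_ (by ext)
    exact FreeGroup.ext_hom _ _ h
  exact funext fun x => DFunLike.congr_fun key x

end Lift

end NCTorus

end NoncommutativeTorus

/-! ## Group actions, spectral subspaces and the spectral subspace assumption -/

section Actions

/-- A (strongly continuous) action of a topological group `G` on a C*-algebra `A`. Each `α g` is
automatically a `*`-automorphism, with inverse `α g⁻¹`. -/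
structure CStarAction (G : Type v) [Group G] [TopologicalSpace G] (A : Type u)
    [NonUnitalCStarAlgebra A] where
  /-- the homomorphism `g ↦ α_g` -/
  toHom : G →* (A →⋆ₙₐ[ℂ] A)
  continuous_apply : ∀ a : A, Continuous fun g : G => toHom g a

namespace CStarAction

variable {G : Type v} [TopologicalSpace G] {A : Type u} [NonUnitalCStarAlgebra A]

instance [Group G] : CoeFun (CStarAction G A) (fun _ => G → A →⋆ₙₐ[ℂ] A) := ⟨fun α => α.toHom⟩

section Group

variable [Group G]

theorem mul_apply (α : CStarAction G A) (g h : G) (a : A) : α (g * h) a = α g (α h a) := by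
  rw [map_mul]; rfl

theorem one_apply (α : CStarAction G A) (a : A) : α 1 a = a := by
  rw [map_one]; rfl

open scoped CStarAlgebra in
/-- Strong continuity only has to be checked on a dense set. -/
theorem continuous_of_dense (φ : G → A →⋆ₙₐ[ℂ] A) {S : Set A} (hS : Dense S)
    (h : ∀ a ∈ S, Continuous fun g => φ g a) (a : A) : Continuous fun g => φ g a := by
  refine continuous_of_uniform_approx_of_continuous fun u hu => ?_
  obtain ⟨ε, hε, hu⟩ := Metric.mem_uniformity_dist.1 hu
  obtain ⟨b, hb, hab⟩ := Metric.mem_closure_iff.1 (hS a) ε hε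
  refine ⟨fun g => φ g b, h b hb, fun g => hu ?_⟩
  refine lt_of_le_of_lt ?_ hab
  rw [dist_eq_norm, dist_eq_norm, ← map_sub]
  exact NonUnitalStarAlgHom.norm_apply_le (φ g) (a - b)

/-- The trivial action. -/
def trivial : CStarAction G A where
  toHom := 1
  continuous_apply _ := continuous_const

/-- The fixed point algebra `A^G`. -/
def fixedPoints (α : CStarAction G A) : NonUnitalStarSubalgebra ℂ A where
  carrier := {a | ∀ g, α g a = a}
  add_mem' ha hb g := by rw [map_add, ha g, hb g]
  zero_mem' g := map_zero _
  mul_mem' ha hb g := by rw [map_mul, ha g, hb g]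
  smul_mem' c a ha g := by rw [map_smul, ha g]
  star_mem' ha g := by rw [map_star, ha g]

open scoped CStarAlgebra in
instance isClosed_fixedPoints (α : CStarAction G A) : IsClosed (α.fixedPoints : Set A) := by
  change IsClosed {a | ∀ g, α g a = a}
  rw [Set.ofPred_forall]
  exact isClosed_iInter fun g => isClosed_eq (map_continuous (α g)) continuous_id

/-- The restriction of an action to an invariant closed `*`-subalgebra. -/
def restrict (α : CStarAction G A) (S : NonUnitalStarSubalgebra ℂ A) [IsClosed (S : Set A)]
    (hS : ∀ g, ∀ a ∈ S, α g a ∈ S) : CStarAction G S where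
  toHom :=
    { toFun := fun g =>
        { toFun := fun a => ⟨α g a, hS g a a.2⟩
          map_smul' := fun c a => Subtype.ext (map_smul (α g) c (a : A))
          map_zero' := Subtype.ext (map_zero (α g))
          map_add' := fun a b => Subtype.ext (map_add (α g) (a : A) b)
          map_mul' := fun a b => Subtype.ext (map_mul (α g) (a : A) b)
          map_star' := fun a => Subtype.ext (map_star (α g) (a : A)) }
      map_one' := NonUnitalStarAlgHom.ext fun a => Subtype.ext (α.one_apply a)
      map_mul' := fun g h => NonUnitalStarAlgHom.ext fun a => Subtype.ext (α.mul_apply g h a) }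
  continuous_apply a := (α.continuous_apply a).subtype_mk _

/-- The diagonal action `g · (a ⊗ b) = α_g a ⊗ β_g b` on the spatial tensor product. -/
def diag {N : Type w} [NonUnitalCStarAlgebra N] (α : CStarAction G A) (β : CStarAction G N) :
    CStarAction G (SpatialTensor A N) where
  toHom :=
    { toFun := fun g => SpatialTensor.map (α g) (β g)
      map_one' := SpatialTensor.hom_ext fun a b => by
        rw [SpatialTensor.map_tmul, one_apply, one_apply]; rfl
      map_mul' := fun g h => SpatialTensor.hom_ext fun a b => by
        rw [SpatialTensor.map_tmul, mul_apply, mul_apply, ← SpatialTensor.map_tmul,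
          ← SpatialTensor.map_tmul]
        rfl }
  continuous_apply := by
    refine continuous_of_dense (fun g => SpatialTensor.map (α g) (β g))
      SpatialTensor.denseRange_of ?_
    rintro _ ⟨x, rfl⟩
    induction x using TensorProduct.induction_on with
    | zero => simpa using continuous_const
    | add x y hx hy => simp only [map_add]; exact hx.add hy
    | tmul a b =>
      have : ∀ g, SpatialTensor.map (α g) (β g) (SpatialTensor.of A N (a ⊗ₜ[ℂ] b)) =
          SpatialTensor.tmul (α g a) (β g b) := fun g => SpatialTensor.map_tmul _ _ a b
      simp only [this]
      exact SpatialTensor.continuous_tmul.comp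
        ((α.continuous_apply a).prodMk (β.continuous_apply b))

@[simp] theorem diag_tmul {N : Type w} [NonUnitalCStarAlgebra N] (α : CStarAction G A)
    (β : CStarAction G N) (g : G) (a : A) (b : N) :
    α.diag β g (SpatialTensor.tmul a b) = SpatialTensor.tmul (α g a) (β g b) :=
  SpatialTensor.map_tmul _ _ a b

/-- The spectral subspace `A_χ = {a | α_g a = χ(g) a for all g}`, for a character `χ`. -/
def spectralSubspace (α : CStarAction G A) (χ : G →ₜ* Circle) : Submodule ℂ A where
  carrier := {a | ∀ g, α g a = (χ g : ℂ) • a}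
  add_mem' ha hb g := by rw [map_add, ha g, hb g, smul_add]
  zero_mem' g := by rw [map_zero, smul_zero]
  smul_mem' c a ha g := by rw [map_smul, ha g, smul_comm]

/-- The norm closure of `A_χ A_χ⋆`, the linear span of the products `a b⋆` with `a`, `b` in `A_χ`,
as a subspace of the fixed point algebra. -/
def spectralIdeal (α : CStarAction G A) (χ : G →ₜ* Circle) : Submodule ℂ α.fixedPoints :=
  (Submodule.span ℂ {x : α.fixedPoints | ∃ a ∈ α.spectralSubspace χ, ∃ b ∈ α.spectralSubspace χ,
    (x : A) = a * star b}).topologicalClosure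

end Group

end CStarAction

/-- Closed two-sided ideals of a C*-algebra. -/
def IsClosedIdeal {B : Type u} [NonUnitalCStarAlgebra B] (I : Submodule ℂ B) : Prop :=
  IsClosed (I : Set B) ∧ ∀ x ∈ I, ∀ b : B, b * x ∈ I ∧ x * b ∈ I

/-- A complemented ideal of a C*-algebra `B`: a closed two-sided ideal `I` for which there is a
closed two-sided ideal `J` with `B = I ⊕ J`. -/
def IsComplementedIdeal {B : Type u} [NonUnitalCStarAlgebra B] (I : Submodule ℂ B) : Prop :=
  IsClosedIdeal I ∧ ∃ J : Submodule ℂ B, IsClosedIdeal J ∧ IsCompl I J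

/-- The spectral subspace assumption. -/
def CStarAction.SpectralSubspaceAssumption {G : Type v} [Group G] [TopologicalSpace G]
    {A : Type u} [NonUnitalCStarAlgebra A] (α : CStarAction G A) : Prop :=
  ∀ χ : G →ₜ* Circle, IsComplementedIdeal (α.spectralIdeal χ)

end Actions

/-! ## The θ-deformation -/

section ThetaDeformation

/-- The `n`-torus. -/
abbrev Torus (n : ℕ) : Type := Fin n → Circle

namespace NCTorus

variable {n : ℕ} (θ : Matrix (Fin n) (Fin n) ℝ)

/-- The `*`-endomorphism `U_j ↦ t_j U_j` of the noncommutative torus. -/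
def gaugeHom (t : Torus n) : NCTorus θ →⋆ₐ[ℂ] NCTorus θ :=
  NCTorus.lift (fun j => (t j : ℂ) • U θ j)
    (fun j => by
      have h := U_mem_unitary θ j
      have h1 : star (t j : ℂ) * (t j : ℂ) = 1 := by
        rw [mul_comm]
        simp [Complex.mul_conj, Circle.normSq_coe]
      rw [Unitary.mem_iff] at h ⊢
      simp only [star_smul, smul_mul_smul_comm, h.1, h.2, h1, mul_comm (t j : ℂ), one_smul,
        and_self])
    (fun j k => by
      simp only [smul_mul_smul_comm, torusRelations_U θ j k]
      rw [smul_comm, mul_comm (t j : ℂ)])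

@[simp] theorem gaugeHom_U (t : Torus n) (j : Fin n) :
    gaugeHom θ t (U θ j) = (t j : ℂ) • U θ j := lift_U _ _ _ j

theorem gaugeHom_one : gaugeHom θ 1 = StarAlgHom.id ℂ (NCTorus θ) :=
  hom_ext fun j => by simp

theorem gaugeHom_mul (s t : Torus n) :
    gaugeHom θ (s * t) = (gaugeHom θ s).comp (gaugeHom θ t) :=
  hom_ext fun j => by simp [smul_smul, mul_comm]

/-- The action `t · U_j = t_j U_j` of the torus on the noncommutative torus. -/
def gaugeAction : CStarAction (Torus n) (NCTorus θ) where
  toHom :=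
    { toFun := fun t => (gaugeHom θ t : NCTorus θ →⋆ₙₐ[ℂ] NCTorus θ)
      map_one' := NonUnitalStarAlgHom.ext fun x => by
        change gaugeHom θ 1 x = x
        rw [gaugeHom_one]; rfl
      map_mul' := fun s t => NonUnitalStarAlgHom.ext fun x => by
        change gaugeHom θ (s * t) x = gaugeHom θ s (gaugeHom θ t x)
        rw [gaugeHom_mul]; rfl }
  continuous_apply := by
    refine CStarAction.continuous_of_dense
      (fun t => (gaugeHom θ t : NCTorus θ →⋆ₙₐ[ℂ] NCTorus θ)) (denseRange_of θ) ?_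
    rintro _ ⟨x, rfl⟩
    change Continuous fun t => gaugeHom θ t (of θ x)
    induction x using MonoidAlgebra.induction_linear with
    | zero => simpa using continuous_const
    | add x y hx hy => simp only [map_add]; exact hx.add hy
    | single g c =>
      have h0 : ∀ g : FreeGroup (Fin n), MonoidAlgebra.single g c = c • MonoidAlgebra.single g (1 : ℂ) :=
        fun g => by simp
      have h1 : (fun t => gaugeHom θ t (of θ (MonoidAlgebra.single g c))) =
          fun t => c • gaugeHom θ t (of θ (MonoidAlgebra.single g 1)) :=
        funext fun t => by rw [h0, map_smul, map_smul]
      rw [h1]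
      refine Continuous.const_smul ?_ c
      clear h1 h0
      induction g using FreeGroup.induction_on with
      | C1 =>
        have h2 : ∀ t : Torus n, gaugeHom θ t (of θ (MonoidAlgebra.single 1 1)) = 1 := fun t => by
          rw [← MonoidAlgebra.one_def, map_one, map_one]
        simp only [h2]
        exact continuous_const
      | of j =>
        change Continuous fun t : Torus n => gaugeHom θ t (U θ j)
        simp only [gaugeHom_U]
        fun_prop
      | inv_of j h =>
        have : ∀ t : Torus n, gaugeHom θ t (of θ (MonoidAlgebra.single (FreeGroup.of j)⁻¹ 1)) =
            star (gaugeHom θ t (of θ (MonoidAlgebra.single (FreeGroup.of j) 1))) := fun t => by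
          rw [← map_star, ← map_star, GroupAlgebra.star_single, star_one]
        exact (continuous_star.comp h).congr fun t => (this t).symm
      | mul g h hg hh =>
        have : ∀ t : Torus n, gaugeHom θ t (of θ (MonoidAlgebra.single (g * h) 1)) =
            gaugeHom θ t (of θ (MonoidAlgebra.single g 1)) *
              gaugeHom θ t (of θ (MonoidAlgebra.single h 1)) := fun t => by
          rw [← map_mul, ← map_mul, MonoidAlgebra.single_mul_single, one_mul]
        simp only [this]
        exact hg.mul hh

end NCTorus

variable {A : Type u} [NonUnitalCStarAlgebra A] {n : ℕ}

/-- The `θ`-deformation `A_θ = (A ⊗ C(𝕋ⁿ)_θ)^{𝕋ⁿ}`: the fixed point algebra of the diagonal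
action. -/
abbrev thetaDeformation (α : CStarAction (Torus n) A) (θ : Matrix (Fin n) (Fin n) ℝ) :
    NonUnitalStarSubalgebra ℂ (SpatialTensor A (NCTorus θ)) :=
  (α.diag (NCTorus.gaugeAction θ)).fixedPoints

theorem diag_trivial_mem_thetaDeformation (α : CStarAction (Torus n) A)
    (θ : Matrix (Fin n) (Fin n) ℝ) (t : Torus n) (x : SpatialTensor A (NCTorus θ))
    (hx : x ∈ thetaDeformation α θ) :
    α.diag (CStarAction.trivial : CStarAction (Torus n) (NCTorus θ)) t x ∈
      thetaDeformation α θ := by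
  intro s
  have h : ∀ y, α.diag (NCTorus.gaugeAction θ) s
      (α.diag (CStarAction.trivial : CStarAction (Torus n) (NCTorus θ)) t y) =
      α.diag (CStarAction.trivial : CStarAction (Torus n) (NCTorus θ)) t
        (α.diag (NCTorus.gaugeAction θ) s y) := by
    refine fun y => congrArg (fun F : SpatialTensor A (NCTorus θ) →⋆ₙₐ[ℂ] _ => F y)
      (SpatialTensor.hom_ext (f := (α.diag (NCTorus.gaugeAction θ) s).comp
        (α.diag (CStarAction.trivial : CStarAction (Torus n) (NCTorus θ)) t))
      (g := (α.diag (CStarAction.trivial : CStarAction (Torus n) (NCTorus θ)) t).comp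
        (α.diag (NCTorus.gaugeAction θ) s)) fun a b => ?_)
    simp only [NonUnitalStarAlgHom.comp_apply, CStarAction.diag_tmul, ← CStarAction.mul_apply,
      mul_comm s t]
    rfl
  rw [h, hx s]

/-- The action `α^(θ)_t (a ⊗ b) = α_t a ⊗ b` of the torus on the `θ`-deformation. -/
def thetaAction (α : CStarAction (Torus n) A) (θ : Matrix (Fin n) (Fin n) ℝ) :
    CStarAction (Torus n) (thetaDeformation α θ) :=
  (α.diag (CStarAction.trivial : CStarAction (Torus n) (NCTorus θ))).restrict
    (thetaDeformation α θ) (diag_trivial_mem_thetaDeformation α θ)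

end ThetaDeformation

end

noncomputable section

universe u v w

/-! ## Faithfulness of the Hilbert space representations -/

section States

open scoped ComplexOrder

variable {B : Type u} [CStarAlgebra B]

/-! Every character `χ` of the torus occurs in the noncommutative torus on a unitary: some monomial
`V` in the generators satisfies `t · V = χ(t)⁻¹ V`. The core of the proof is the identity `(A_θ)_χ =
A_χ ⊗ V`, which is `mem_spectralSubspace_thetaAction_iff`. An element of `A_θ` is fixed by the
diagonal action; if moreover `α ⊗ id` scales it by `χ`, then the gauge action on the second factor
alone scales it by `χ⁻¹`. The gauge action is ergodic, so the `χ⁻¹`-homogeneous part of the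
noncommutative torus is the line `ℂV`, and averaging over Haar measure shows that such an element is
`a ⊗ V` (`exists_eq_tmul_of_homogeneous`).

Now `(a ⊗ V)(b ⊗ V)⋆ = ab⋆ ⊗ 1`: the unitary cancels. The case `χ = 1`, `V = 1` gives the
isomorphism `a ↦ a ⊗ 1` of fixed point algebras (`exists_fixedPoints_equiv`), and for general `χ` it
matches the products generating the two spectral ideals (`image_generators_spectralIdeal`). Being an
isometric linear bijection, it matches their closed spans, and being a `*`-isomorphism, it
transports complemented ideals in both directions.

The analytic input is that `a ↦ a ⊗ V` is isometric for the spatial norm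
(`NCTorus.norm_tmul_unitary`). This needs a representation of `A` attaining `‖a‖`, supplied by
states and the GNS construction (`HilbertRep.exists_norm_le`), and a unital representation of the
noncommutative torus on a nonzero space, supplied by weighted shifts on `ℓ²(ℤⁿ)`. Skew-symmetry of
`θ` enters only through the latter. -/

theorem norm_selfAdjoint_add_I_smul_sq_le {x : B} (hx : IsSelfAdjoint x) (t : ℝ) :
    ‖x + (t * Complex.I : ℂ) • (1 : B)‖ ^ 2 ≤ ‖x‖ ^ 2 + t ^ 2 := by
  rcases subsingleton_or_nontrivial B with hB | hB
  · rw [Subsingleton.elim (x + _) 0, norm_zero]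
    nlinarith [sq_nonneg ‖x‖, sq_nonneg t]
  have h : star (x + (t * Complex.I : ℂ) • (1 : B)) * (x + (t * Complex.I : ℂ) • (1 : B)) =
      x * x + ((t ^ 2 : ℝ) : ℂ) • (1 : B) := by
    rw [star_add, star_smul, hx.star_eq, star_one, add_mul, mul_add, mul_add, smul_mul_smul_comm,
      smul_mul_assoc, mul_smul_comm, mul_one, one_mul, mul_one]
    have h1 : star (t * Complex.I : ℂ) = -(t * Complex.I : ℂ) := by simp
    have h2 : star (t * Complex.I : ℂ) * (t * Complex.I) = ((t ^ 2 : ℝ) : ℂ) := by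
      rw [h1]; push_cast; linear_combination -(t : ℂ) ^ 2 * Complex.I_sq
    rw [h2, h1]
    module
  rw [sq, ← CStarRing.norm_star_mul_self, h]
  refine (norm_add_le _ _).trans (add_le_add ((norm_mul_le _ _).trans (sq _).ge) ?_)
  rw [norm_smul, norm_one, mul_one, Complex.norm_real, Real.norm_of_nonneg (sq_nonneg t)]

/-- Adding `i t` to `x` shifts `Im f(x)` by `t`, while the squared norm grows by at most `t ^ 2`
because the cross terms cancel. A nonzero `Im f(x)` would leave an unbounded surplus `2 t Im f(x)`.
-/
theorem im_apply_eq_zero_of_isSelfAdjoint {f : B →L[ℂ] ℂ} (hf : ‖f‖ ≤ 1) (h1 : f 1 = 1) {x : B}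
    (hx : IsSelfAdjoint x) : (f x).im = 0 := by
  have key : ∀ t : ℝ, ((f x).im + t) ^ 2 ≤ ‖x‖ ^ 2 + t ^ 2 := fun t => by
    have h2 : f (x + (t * Complex.I : ℂ) • (1 : B)) = f x + t * Complex.I := by
      rw [map_add, map_smul, h1, smul_eq_mul, mul_one]
    have h3 : |(f x).im + t| ≤ ‖x + (t * Complex.I : ℂ) • (1 : B)‖ := by
      refine le_trans ?_ (f.le_of_opNorm_le hf _ |>.trans_eq (one_mul _))
      rw [h2]
      refine le_trans (le_of_eq ?_) (Complex.abs_im_le_norm _)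
      simp
    calc ((f x).im + t) ^ 2 = |(f x).im + t| ^ 2 := (sq_abs _).symm
      _ ≤ _ := by gcongr
      _ ≤ _ := norm_selfAdjoint_add_I_smul_sq_le hx t
  by_contra h
  -- This `t` makes the cross term `2 t Im f(x)` equal to `‖x‖ ^ 2 + 1`, just beyond the permitted
  -- `‖x‖ ^ 2`.
  have := key ((‖x‖ ^ 2 + 1) / (2 * (f x).im))
  have h4 : 2 * (f x).im * ((‖x‖ ^ 2 + 1) / (2 * (f x).im)) = ‖x‖ ^ 2 + 1 := by
    field_simp
  nlinarith [sq_nonneg (f x).im]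

variable [PartialOrder B] [StarOrderedRing B]

/-- A contractive unital functional on a C*-algebra is positive. -/
theorem apply_nonneg_of_norm_le_one {f : B →L[ℂ] ℂ} (hf : ‖f‖ ≤ 1) (h1 : f 1 = 1) {x : B}
    (hx : 0 ≤ x) : 0 ≤ f x := by
  have hsa : IsSelfAdjoint x := .of_nonneg hx
  have him := im_apply_eq_zero_of_isSelfAdjoint hf h1 hsa
  refine Complex.le_def.2 ⟨?_, him.symm⟩
  -- Since `0 ≤ ‖x‖ - x ≤ ‖x‖`, the number `‖x‖ - f x` has modulus at most `‖x‖`, which forces `Re f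
  -- x ≥ 0`.
  have h2 : ‖algebraMap ℝ B ‖x‖ - x‖ ≤ ‖x‖ := by
    rw [CStarAlgebra.norm_le_iff_le_algebraMap _ (norm_nonneg x)
      (sub_nonneg.2 hsa.le_algebraMap_norm_self)]
    exact sub_le_self _ hx
  have h3 : f (algebraMap ℝ B ‖x‖ - x) = ‖x‖ - f x := by
    rw [map_sub, Algebra.algebraMap_eq_smul_one, ← Complex.coe_smul, map_smul, h1, smul_eq_mul,
      mul_one]
  have h4 : ‖(‖x‖ : ℂ) - f x‖ ≤ ‖x‖ := by
    rw [← h3]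
    exact (f.le_of_opNorm_le hf _ |>.trans_eq (one_mul _)).trans h2
  have h5 := (le_abs_self _).trans ((Complex.abs_re_le_norm _).trans h4)
  simp only [Complex.sub_re, Complex.ofReal_re] at h5
  rw [Complex.zero_re]
  linarith

/-- The norm of a positive element belongs to its spectrum, so `1 + ‖b‖` belongs to the spectrum of
`1 + b`. -/
theorem norm_one_add_of_nonneg [Nontrivial B] {b : B} (hb : 0 ≤ b) : ‖1 + b‖ = 1 + ‖b‖ := by
  refine le_antisymm ((norm_add_le _ _).trans_eq (by rw [norm_one])) ?_
  have h := CStarAlgebra.norm_mem_spectrum_of_nonneg (a := b) hb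
  have h2 : 1 + ‖b‖ ∈ spectrum ℝ (1 + b) := by
    have := (spectrum.add_mem_add_iff (r := ‖b‖) (s := (1 : ℝ)) (a := b)).2 h
    rw [map_one] at this
    rwa [add_comm ‖b‖] at this
  exact (le_abs_self _).trans (spectrum.norm_le_norm_of_mem h2)

/-- The norm of a positive element is attained by a state. -/
theorem exists_state_apply_eq_norm [Nontrivial B] {b : B} (hb : 0 ≤ b) :
    ∃ f : B →ₚ[ℂ] ℂ, f 1 = 1 ∧ f b = ‖b‖ := by
  -- Hahn–Banach is applied at `1 + b` rather than at `b`: as `‖1 + b‖ = 1 + ‖b‖`, a norming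
  -- functional has to attain both bounds at once, so it is unital, hence a state, and takes the
  -- value `‖b‖` at `b`.
  obtain ⟨g, hg, hgb⟩ := exists_dual_vector'' ℂ (1 + b)
  rw [norm_one_add_of_nonneg hb, map_add] at hgb
  have hle : ∀ x, ‖g x‖ ≤ ‖x‖ := fun x => (g.le_of_opNorm_le hg x).trans_eq (one_mul _)
  have aux : ∀ (z w : ℂ) (r s : ℝ), ‖z‖ ≤ r → ‖w‖ ≤ s → z + w = r + s → z = r := by
    intro z w r s hz hw hzw
    have h1 := Complex.ext_iff.1 hzw
    simp only [Complex.add_re, Complex.add_im, Complex.ofReal_re, Complex.ofReal_im] at h1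
    have hr : z.re = r := le_antisymm ((Complex.re_le_norm z).trans hz)
      (by linarith [(Complex.re_le_norm w).trans hw])
    have h2 : z.re ^ 2 + z.im ^ 2 ≤ r ^ 2 := by
      rw [← Complex.normSq_add_mul_I, Complex.re_add_im, Complex.normSq_eq_norm_sq]
      gcongr
    refine Complex.ext (by simpa using hr) ?_
    rw [hr] at h2
    simpa using pow_eq_zero_iff (two_ne_zero) |>.1 (le_antisymm (by linarith) (sq_nonneg z.im))
  have h1 : g 1 = 1 := by
    simpa using aux (g 1) (g b) 1 ‖b‖ ((hle 1).trans_eq norm_one) (hle b) (by simpa using hgb)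
  have h2 : g b = ‖b‖ := by rw [h1] at hgb; simpa using hgb
  exact ⟨PositiveLinearMap.mk₀ (g : B →ₗ[ℂ] ℂ) fun x hx => apply_nonneg_of_norm_le_one hg h1 hx,
    h1, h2⟩

/-- For a state attaining `‖a⋆ a‖`, the class of `1` in the GNS space is a unit vector, and `a`
moves it to a vector of norm `‖a‖`. -/
theorem exists_norm_le_norm_gnsNonUnitalStarAlgHom [Nontrivial B] (a : B) :
    ∃ f : B →ₚ[ℂ] ℂ, ‖a‖ ≤ ‖f.gnsNonUnitalStarAlgHom a‖ := by
  obtain ⟨f, h1, h2⟩ := exists_state_apply_eq_norm (star_mul_self_nonneg a)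
  refine ⟨f, ?_⟩
  have hn : ∀ x : B, (‖f.toPreGNS x‖ : ℂ) ^ 2 = f (star x * x) := fun x => by
    rw [PositiveLinearMap.preGNS_norm_sq]; rfl
  have hξ : ‖f.toPreGNS 1‖ = 1 := by
    have := hn 1
    rw [star_one, one_mul, h1] at this
    exact (pow_eq_one_iff_of_nonneg (norm_nonneg _) two_ne_zero).1 (by exact_mod_cast this)
  have ha : ‖f.toPreGNS a‖ = ‖a‖ := by
    have := hn a
    rw [h2, CStarRing.norm_star_mul_self, ← sq] at this
    exact (pow_left_inj₀ (norm_nonneg _) (norm_nonneg _) two_ne_zero).1 (by exact_mod_cast this)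
  have := (f.gnsNonUnitalStarAlgHom a).le_opNorm (f.toPreGNS 1 : f.GNS)
  rw [PositiveLinearMap.gnsNonUnitalStarAlgHom_apply_coe, UniformSpace.Completion.norm_coe,
    UniformSpace.Completion.norm_coe, hξ, mul_one] at this
  refine le_trans (le_of_eq ?_) this
  rw [← ha, PositiveLinearMap.leftMulMapPreGNS_apply]
  simp

end States

/-- Every element of a C*-algebra attains its norm in some representation. -/
theorem HilbertRep.exists_norm_le {A : Type u} [NonUnitalCStarAlgebra A] (a : A) :
    ∃ ρ : HilbertRep A, ‖a‖ ≤ ‖ρ.π a‖ := by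
  -- The state argument needs a unit, so the GNS representation is formed on the unitization and
  -- restricted along the isometric inclusion of `A`.
  let := CStarAlgebra.spectralOrder (Unitization ℂ A)
  have := CStarAlgebra.spectralOrderedRing (Unitization ℂ A)
  obtain ⟨f, hf⟩ := exists_norm_le_norm_gnsNonUnitalStarAlgHom (a : Unitization ℂ A)
  refine ⟨{ H := f.GNS, π := f.gnsNonUnitalStarAlgHom.comp (Unitization.inrNonUnitalStarAlgHom ℂ A) },
    ?_⟩
  rw [Unitization.norm_inr] at hf
  exact hf

/-! ## Characters of the torus -/

section Characters

-- A character different from every `z ^ m` is orthogonal to all Fourier monomials. Their span is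
-- uniformly dense, so the character is a uniform limit of functions orthogonal to it, although its
-- `L²` norm is `1`.
open MeasureTheory AddCircle in
theorem Circle.exists_eq_zpow (χ : Circle →ₜ* Circle) : ∃ m : ℤ, ∀ z, χ z = z ^ m := by
  have : Fact (0 < 2 * Real.pi) := ⟨Real.two_pi_pos⟩
  by_contra! hχ
  let f : C(AddCircle (2 * Real.pi), ℂ) := ⟨fun x => (χ x.toCircle : ℂ), by fun_prop⟩
  have horth : ∀ m : ℤ, ∫ x, star (f x) * fourier m x ∂haarAddCircle = 0 := fun m => by
    obtain ⟨z, hz⟩ := hχ m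
    obtain ⟨y, rfl⟩ : ∃ y : AddCircle (2 * Real.pi), y.toCircle = z := by
      simpa only [homeomorphCircle_apply] using
        (homeomorphCircle Real.two_pi_pos.ne').surjective z
    set I := ∫ x, star (f x) * fourier m x ∂haarAddCircle with hI
    -- Translating by `y` multiplies the integral by the integrand's value at `y`. That value is not
    -- `1`, as the two characters differ there, so the integral vanishes.
    have h1 : I = (star (f y) * fourier m y) * I := by
      conv_lhs => rw [hI, ← integral_add_left_eq_self _ y]
      rw [hI, ← integral_const_mul]
      congr 1; funext x
      simp only [f, ContinuousMap.coe_mk, toCircle_add, map_mul, Circle.coe_mul, star_mul',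
        fourier_apply, smul_add]
      ring
    by_contra h0
    have h2 : star (f y) * fourier m y = 1 := by
      have : (star (f y) * fourier m y - 1) * I = 0 := by linear_combination -h1
      exact sub_eq_zero.1 ((mul_eq_zero.1 this).resolve_right h0)
    refine hz (Circle.ext ?_)
    have h3 : f y * star (f y) = 1 := by
      simp [f, Complex.mul_conj, Circle.normSq_coe]
    calc f y = f y * (star (f y) * fourier m y) := by rw [h2, mul_one]
      _ = fourier m y := by rw [← mul_assoc, h3, one_mul]
      _ = _ := by rw [fourier_apply, toCircle_zsmul]
  have hint : ∀ g : C(AddCircle (2 * Real.pi), ℂ),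
      Integrable (fun x => star (f x) * g x) haarAddCircle := fun g =>
    Continuous.integrable_of_hasCompactSupport (by fun_prop) (HasCompactSupport.of_compactSpace _)
  have hspan : ∀ g ∈ Submodule.span ℂ (Set.range (fourier (T := 2 * Real.pi))),
      ∫ x, star (f x) * g x ∂haarAddCircle = 0 := by
    intro g hg
    induction hg using Submodule.span_induction with
    | mem g hg => obtain ⟨m, rfl⟩ := hg; exact horth m
    | zero => simp
    | add g h _ _ hg hh =>
      simp only [ContinuousMap.add_apply, mul_add]
      rw [integral_add (hint g) (hint h), hg, hh, add_zero]
    | smul c g _ hg =>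
      simp only [ContinuousMap.smul_apply, smul_eq_mul, mul_left_comm _ c]
      rw [integral_const_mul, hg, mul_zero]
  have hf : f ∈ closure (Submodule.span ℂ (Set.range (fourier (T := 2 * Real.pi))) : Set _) := by
    rw [← Submodule.topologicalClosure_coe, span_fourier_closure_eq_top]
    trivial
  obtain ⟨g, hg, hfg⟩ := Metric.mem_closure_iff.1 hf 1 one_pos
  have hff : ∀ x, star (f x) * f x = 1 := fun x => by
    rw [mul_comm]; simp [f, Complex.mul_conj, Circle.normSq_coe]
  have h1 : ∫ x, star (f x) * (f - g) x ∂haarAddCircle = 1 := by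
    simp only [ContinuousMap.sub_apply, mul_sub]
    rw [integral_sub (hint f) (hint g), hspan g hg]
    simp only [hff, integral_const, probReal_univ, one_smul, sub_zero]
  have h2 : ‖∫ x, star (f x) * (f - g) x ∂haarAddCircle‖ ≤ ‖f - g‖ := by
    refine (norm_integral_le_of_norm_le_const (C := ‖f - g‖) (.of_forall fun x => ?_)).trans_eq
      (by simp)
    rw [norm_mul]
    have : ‖star (f x)‖ = 1 := by rw [norm_star]; exact Circle.norm_coe _
    rw [this, one_mul]
    exact ContinuousMap.norm_coe_le_norm _ x
  rw [h1, norm_one, ← dist_eq_norm] at h2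
  exact absurd hfg h2.not_gt

/-- The characters of the torus are the monomials. -/
theorem Torus.exists_eq_prod_zpow {n : ℕ} (χ : Torus n →ₜ* Circle) :
    ∃ m : Fin n → ℤ, ∀ t, χ t = ∏ j, t j ^ m j := by
  classical
  choose m hm using fun j => Circle.exists_eq_zpow
    (χ.comp { MonoidHom.mulSingle (fun _ => Circle) j with
      continuous_toFun := continuous_mulSingle (A := fun _ : Fin n => Circle) j })
  refine ⟨m, fun t => ?_⟩
  conv_lhs => rw [← Finset.univ_prod_mulSingle t]
  rw [map_prod]
  exact Finset.prod_congr rfl fun j _ => hm j (t j)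

theorem Circle.eq_zero_of_forall_zpow_eq_one {m : ℤ} (h : ∀ z : Circle, z ^ m = 1) : m = 0 := by
  by_contra hm
  -- The `m`-th power of this point is `-1`.
  have h1 := h (Circle.exp (Real.pi / m))
  rw [← Circle.exp_zsmul, zsmul_eq_mul, mul_div_cancel₀ _ (by exact_mod_cast hm)] at h1
  have := congrArg (fun z : Circle => (z : ℂ)) h1
  simp only [Circle.coe_exp, Complex.exp_pi_mul_I, Circle.coe_one] at this
  norm_num at this

/-- A homomorphism of the free group with commuting values on the generators kills every word on
which all characters are trivial. -/
theorem FreeGroup.map_eq_one_of_forall_lift_eq_one {n : ℕ} {Q : Type*} [Group Q]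
    (φ : FreeGroup (Fin n) →* Q) (hφ : ∀ j k, Commute (φ (of j)) (φ (of k)))
    {g : FreeGroup (Fin n)} (hg : ∀ t : Torus n, FreeGroup.lift t g = 1) : φ g = 1 := by
  classical
  let ab : FreeGroup (Fin n) →* (Fin n → Multiplicative ℤ) :=
    FreeGroup.lift fun j => Pi.mulSingle j (Multiplicative.ofAdd 1)
  have hcomm : Pairwise fun j k => ∀ x y : Multiplicative ℤ,
      Commute (zpowersHom Q (φ (of j)) x) (zpowersHom Q (φ (of k)) y) :=
    fun j k _ x y => (hφ j k).zpow_zpow x.toAdd y.toAdd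
  -- The values on the generators commute, so `φ` depends only on the exponent sums of a word.
  have h1 : φ = (MonoidHom.noncommPiCoprod (fun j => zpowersHom Q (φ (of j))) hcomm).comp ab := by
    refine FreeGroup.ext_hom _ _ fun j => ?_
    rw [MonoidHom.comp_apply, FreeGroup.lift_apply_of, MonoidHom.noncommPiCoprod_mulSingle]
    simp
  -- Torus points with a single nontrivial coordinate `j` isolate the exponent sum of the `j`-th
  -- letter.
  have h2 : ab g = 1 := by
    funext j
    refine Multiplicative.toAdd.injective (Circle.eq_zero_of_forall_zpow_eq_one fun z => ?_)
    have h3 : FreeGroup.lift (Pi.mulSingle j z : Torus n) =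
        ((zpowersHom Circle z).comp (Pi.evalMonoidHom _ j)).comp ab := by
      refine FreeGroup.ext_hom _ _ fun k => ?_
      rw [MonoidHom.comp_apply, FreeGroup.lift_apply_of, FreeGroup.lift_apply_of]
      rcases eq_or_ne k j with rfl | h
      · simp
      · simp [Pi.mulSingle_eq_of_ne h, Pi.mulSingle_eq_of_ne h.symm]
    have h4 := DFunLike.congr_fun h3 g
    rw [hg] at h4
    exact h4.symm
  rw [h1, MonoidHom.comp_apply, h2, _root_.map_one]

end Characters

/-! ## Words in the generators of the noncommutative torus -/

namespace NCTorus

variable {n : ℕ} (θ : Matrix (Fin n) (Fin n) ℝ)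

/-- The unitary representation of the free group given by the generators `U_1, …, U_n`. -/
def word : FreeGroup (Fin n) →* unitary (NCTorus θ) :=
  FreeGroup.lift fun j => ⟨U θ j, U_mem_unitary θ j⟩

theorem of_single_one (g : FreeGroup (Fin n)) : of θ (MonoidAlgebra.single g 1) = word θ g := by
  have h : ((of θ : _ →⋆ₐ[ℂ] _) : _ →* NCTorus θ).comp (MonoidAlgebra.of ℂ (FreeGroup (Fin n))) =
      (unitary (NCTorus θ)).subtype.comp (word θ) :=
    FreeGroup.ext_hom _ _ fun j => by
      simp only [MonoidHom.comp_apply, word, FreeGroup.lift_apply_of]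
      rfl
  exact DFunLike.congr_fun h g

theorem gaugeHom_word (t : Torus n) (g : FreeGroup (Fin n)) :
    gaugeHom θ t (word θ g) = (FreeGroup.lift t g : ℂ) • (word θ g : NCTorus θ) := by
  induction g using FreeGroup.induction_on with
  | C1 => simp
  | of j => simp [word]
  | inv_of j h =>
    rw [map_inv, map_inv, ← Unitary.star_eq_inv, Unitary.coe_star, map_star, h, star_smul,
      Circle.coe_inv_eq_conj]
    rfl
  | mul g h hg hh =>
    rw [map_mul, map_mul, Submonoid.coe_mul, map_mul, hg, hh, smul_mul_smul_comm, Circle.coe_mul]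

/-- The subgroup of scalar unitaries. -/
def scalarUnitary (D : Type u) [CStarAlgebra D] : Subgroup (unitary D) where
  carrier := {u | ∃ c : ℂ, (u : D) = c • (1 : D)}
  one_mem' := ⟨1, by simp⟩
  mul_mem' := by
    rintro a b ⟨c, hc⟩ ⟨d, hd⟩
    exact ⟨c * d, by rw [Submonoid.coe_mul, hc, hd, smul_mul_smul_comm, one_mul]⟩
  inv_mem' := by
    rintro a ⟨c, hc⟩
    exact ⟨star c, by rw [← Unitary.star_eq_inv, Unitary.coe_star, hc, star_smul, star_one]⟩

instance (D : Type u) [CStarAlgebra D] : (scalarUnitary D).Normal where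
  conj_mem := by
    rintro a ⟨c, hc⟩ g
    refine ⟨c, ?_⟩
    rw [Submonoid.coe_mul, Submonoid.coe_mul, hc, mul_smul_comm, mul_one, smul_mul_assoc,
      ← Submonoid.coe_mul, mul_inv_cancel, Submonoid.coe_one]

/-- The generators commute modulo scalar unitaries, so a word of trivial degree becomes trivial in
the quotient by `scalarUnitary`. -/
theorem exists_word_eq_smul_one {g : FreeGroup (Fin n)}
    (hg : ∀ t : Torus n, FreeGroup.lift t g = 1) : ∃ c : ℂ, (word θ g : NCTorus θ) = c • 1 := by
  refine (QuotientGroup.eq_one_iff (N := scalarUnitary (NCTorus θ)) (word θ g)).1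
    (FreeGroup.map_eq_one_of_forall_lift_eq_one
      ((QuotientGroup.mk' (scalarUnitary (NCTorus θ))).comp (word θ)) (fun j k => ?_) hg)
  simp only [word, MonoidHom.comp_apply, FreeGroup.lift_apply_of]
  rw [commute_iff_eq, ← map_mul, ← map_mul]
  refine QuotientGroup.eq.2 ⟨Complex.exp (2 * Real.pi * Complex.I * θ k j), ?_⟩
  set u : unitary (NCTorus θ) := ⟨U θ j, U_mem_unitary θ j⟩ * ⟨U θ k, U_mem_unitary θ k⟩
  rw [Submonoid.coe_mul, Submonoid.coe_mul, torusRelations_U θ k j, mul_smul_comm]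
  change _ • ((u⁻¹ : unitary (NCTorus θ)) * (u : NCTorus θ)) = _
  rw [← Submonoid.coe_mul, inv_mul_cancel, Submonoid.coe_one]

/-- Every character of the torus occurs in the noncommutative torus, on a unitary. -/
theorem exists_unitary_gauge (χ : Torus n →ₜ* Circle) :
    ∃ V ∈ unitary (NCTorus θ), ∀ t, gaugeAction θ t V = (χ t : ℂ) • V := by
  obtain ⟨m, hm⟩ := Torus.exists_eq_prod_zpow χ
  -- The ordered monomial `U_1 ^ m_1 ⋯ U_n ^ m_n` has degree `∏ t_j ^ m_j`, which is `χ`.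
  let g : FreeGroup (Fin n) := (List.ofFn fun j => FreeGroup.of j ^ m j).prod
  refine ⟨word θ g, (word θ g).2, fun t => ?_⟩
  refine (gaugeHom_word θ t g).trans ?_
  rw [hm t, map_list_prod, List.map_ofFn, List.prod_ofFn]
  simp

end NCTorus

/-! ## The regular representation of the noncommutative torus -/

section WeightedShift

variable {ι : Type u}

/-- The weighted permutation operator `(T f) i = c i * f (e i)` on `ℓ²`, as a linear map. -/
def weightedPermLinearMap (e : Equiv.Perm ι) (c : ι → Circle) :
    lp (fun _ : ι => ℂ) 2 →ₗ[ℂ] lp (fun _ : ι => ℂ) 2 where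
  toFun f := ⟨fun i => c i * f (e i), memℓp_gen (by
    simpa [Function.comp_def, Circle.norm_coe] using
      (e.summable_iff.2 ((memℓp_gen_iff (p := 2) (by simp)).1 f.2)))⟩
  map_add' f g := by ext i; exact mul_add _ _ _
  map_smul' r f := by ext i; simp [mul_left_comm]

theorem weightedPermLinearMap_apply (e : Equiv.Perm ι) (c : ι → Circle)
    (f : lp (fun _ : ι => ℂ) 2) (i : ι) : weightedPermLinearMap e c f i = c i * f (e i) := rfl

/-- The unitary weighted permutation operator `(T f) i = c i * f (e i)` on `ℓ²`. -/
def weightedPerm (e : Equiv.Perm ι) (c : ι → Circle) :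
    lp (fun _ : ι => ℂ) 2 ≃ₗᵢ[ℂ] lp (fun _ : ι => ℂ) 2 where
  toLinearEquiv := LinearEquiv.ofLinearMap (weightedPermLinearMap e c)
    (weightedPermLinearMap e.symm fun i => (c (e.symm i))⁻¹)
    (by ext f i; simp [weightedPermLinearMap_apply])
    (by ext f i; simp [weightedPermLinearMap_apply])
  norm_map' f := by
    change ‖weightedPermLinearMap e c f‖ = ‖f‖
    rw [lp.norm_eq_tsum_rpow (by simp), lp.norm_eq_tsum_rpow (by simp)]
    congr 1
    rw [← e.tsum_eq fun i => ‖f i‖ ^ (2 : ENNReal).toReal]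
    simp [weightedPermLinearMap_apply, Circle.norm_coe]

end WeightedShift

namespace NCTorus

variable {n : ℕ} (θ : Matrix (Fin n) (Fin n) ℝ)

/-- The weighted shifts on `ℓ²(ℤⁿ)` that represent the generators of the noncommutative torus. -/
def shift (j : Fin n) :
    unitary (lp (fun _ : Fin n → ℤ => ℂ) 2 →L[ℂ] lp (fun _ : Fin n → ℤ => ℂ) 2) :=
  Unitary.linearIsometryEquiv.symm (weightedPerm (Equiv.subRight (Pi.single j 1))
    fun m => Circle.exp (Real.pi * ∑ k, θ j k * m k))

theorem shift_apply (j : Fin n) (f : lp (fun _ : Fin n → ℤ => ℂ) 2) (m : Fin n → ℤ) :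
    (shift θ j : lp (fun _ : Fin n → ℤ => ℂ) 2 →L[ℂ] lp (fun _ : Fin n → ℤ => ℂ) 2) f m =
      Complex.exp ((Real.pi * ∑ k, θ j k * m k : ℝ) * Complex.I) * f (m - Pi.single j 1) := rfl

/-- Interchanging two shifts changes the phase by `π (θ j k - θ k j)`. Skew-symmetry turns this into
`2π θ j k`, which is why the weights carry `π` and not `2π`. -/
theorem torusRelations_shift (hθ : θ.transpose = -θ) :
    TorusRelations θ fun j =>
      (shift θ j : lp (fun _ : Fin n → ℤ => ℂ) 2 →L[ℂ] lp (fun _ : Fin n → ℤ => ℂ) 2) := by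
  intro j k
  ext f m
  have hs : ∀ i l : Fin n, ∑ r, θ i r * ((m - Pi.single l 1 : Fin n → ℤ) r : ℝ) =
      (∑ r, θ i r * (m r : ℝ)) - θ i l := fun i l => by
    simp [mul_sub, Finset.sum_sub_distrib, Pi.single_apply]
  have hkj : θ k j = -θ j k := by
    rw [← Matrix.transpose_apply θ, hθ, Matrix.neg_apply]
  rw [mul_apply_eq_comp, smul_apply, mul_apply_eq_comp,
    lp.coeFn_smul, Pi.smul_apply, smul_eq_mul, shift_apply, shift_apply, shift_apply, shift_apply,
    hs, hs, sub_right_comm m, ← mul_assoc, ← mul_assoc, ← mul_assoc, ← Complex.exp_add,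
    ← Complex.exp_add, ← Complex.exp_add]
  congr 2
  rw [hkj]
  push_cast
  ring

/-- The homomorphism of the noncommutative torus to the operators on `ℓ²(ℤⁿ)`. -/
def shiftHom (hθ : θ.transpose = -θ) :
    NCTorus θ →⋆ₐ[ℂ] (lp (fun _ : Fin n → ℤ => ℂ) 2 →L[ℂ] lp (fun _ : Fin n → ℤ => ℂ) 2) :=
  lift (fun j => (shift θ j : lp (fun _ : Fin n → ℤ => ℂ) 2 →L[ℂ] lp (fun _ : Fin n → ℤ => ℂ) 2))
    (fun j => (shift θ j).2) (torusRelations_shift θ hθ)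

/-- The representation of the noncommutative torus on `ℓ²(ℤⁿ)`. -/
def regularRep (hθ : θ.transpose = -θ) : HilbertRep (NCTorus θ) :=
  { H := lp (fun _ : Fin n → ℤ => ℂ) 2
    π := (shiftHom θ hθ).toNonUnitalStarAlgHom }

theorem regularRep_one (hθ : θ.transpose = -θ) : (regularRep θ hθ).π 1 = 1 :=
  map_one (shiftHom θ hθ)

theorem norm_regularRep_apply (hθ : θ.transpose = -θ) {V : NCTorus θ}
    (hV : V ∈ unitary (NCTorus θ)) (y : (regularRep θ hθ).H) :
    ‖(regularRep θ hθ).π V y‖ = ‖y‖ := by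
  have h : (regularRep θ hθ).π V ∈ unitary ((regularRep θ hθ).H →L[ℂ] (regularRep θ hθ).H) := by
    rw [Unitary.mem_iff, ← map_star, ← map_mul, ← map_mul, (Unitary.mem_iff.1 hV).1,
      (Unitary.mem_iff.1 hV).2, regularRep_one]
    exact ⟨rfl, rfl⟩
  exact (Unitary.linearIsometryEquiv ⟨_, h⟩).norm_map y

/-- Tensoring with a unitary of the noncommutative torus is isometric. -/
theorem norm_tmul_unitary (hθ : θ.transpose = -θ) {A : Type u} [NonUnitalCStarAlgebra A] (a : A)
    {V : NCTorus θ} (hV : V ∈ unitary (NCTorus θ)) : ‖SpatialTensor.tmul a V‖ = ‖a‖ := by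
  obtain ⟨y, hy⟩ : ∃ y : (regularRep θ hθ).H, ‖y‖ = 1 :=
    ⟨(lp.single 2 0 1 : lp (fun _ : Fin n → ℤ => ℂ) 2), by
      exact (lp.norm_single (E := fun _ : Fin n → ℤ => ℂ) two_pos 0 1).trans norm_one⟩
  -- If `1 = 0`, the unital regular representation would kill the unit vector `y`. Nontriviality is
  -- needed for `‖V‖ = 1`.
  have hnt : Nontrivial (NCTorus θ) := by
    refine ⟨1, 0, fun h => ?_⟩
    have h1 := norm_regularRep_apply θ hθ (one_mem _) y
    rw [h, map_zero, hy] at h1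
    simp at h1
  refine le_antisymm ((SpatialTensor.norm_tmul_le a V).trans_eq ?_) ?_
  · rw [CStarRing.norm_of_mem_unitary hV, mul_one]
  obtain ⟨ρ, hρ⟩ := HilbertRep.exists_norm_le a
  refine hρ.trans ?_
  have h1 : ‖HilbertTensor.mapL (ρ.π a) ((regularRep θ hθ).π V)‖ ≤ ‖SpatialTensor.tmul a V‖ :=
    (le_ciSup (HilbertRep.bddAbove_tensorSeminorm (a ⊗ₜ[ℂ] V)) (ρ, regularRep θ hθ)).trans_eq
      (SpatialTensor.norm_of _).symm
  refine ContinuousLinearMap.opNorm_le_bound _ (norm_nonneg _) fun x => ?_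
  -- The image of `V` preserves norms, so testing on `x ⊗ y` with `y` a unit vector bounds `‖ρ.π a
  -- x‖` by `‖a ⊗ V‖ ‖x‖`.
  have h2 := ContinuousLinearMap.le_of_opNorm_le _ h1 (HilbertTensor.of (x ⊗ₜ[ℂ] y))
  rwa [HilbertTensor.mapL_tmul, HilbertTensor.norm_of, HilbertTensor.norm_of,
    TensorProduct.norm_tmul, TensorProduct.norm_tmul, norm_regularRep_apply θ hθ hV, hy, mul_one,
    mul_one] at h2

end NCTorus

/-! ## Averaging an action against a character -/

section Twirl

open MeasureTheory

variable {G : Type v} [Group G] [TopologicalSpace G] [CompactSpace G]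
  [MeasurableSpace G] [BorelSpace G] {A : Type u} [NonUnitalCStarAlgebra A]

namespace CStarAction

variable (α : CStarAction G A) (χ : G →ₜ* Circle) (μ : Measure G) [IsProbabilityMeasure μ]

theorem integrable_smul_apply (a : A) : Integrable (fun g => (χ g : ℂ) • α g a) μ := by
  have := α.continuous_apply a
  exact Continuous.integrable_of_hasCompactSupport (by fun_prop)
    (HasCompactSupport.of_compactSpace _)

/-- The average `∫ χ(g) α_g(a) dg` of an action against a character. -/
def twirl : A →L[ℂ] A :=
  LinearMap.mkContinuous
    { toFun := fun a => ∫ g, (χ g : ℂ) • α g a ∂μ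
      map_add' := fun a b => by
        simp only [map_add, smul_add]
        exact integral_add (α.integrable_smul_apply χ μ a) (α.integrable_smul_apply χ μ b)
      map_smul' := fun c a => by
        simp only [map_smul, smul_comm _ c]
        exact integral_smul c _ }
    1 fun a => by
      refine (norm_integral_le_of_norm_le_const (C := ‖a‖) (.of_forall fun g => ?_)).trans_eq
        (by simp)
      rw [norm_smul, Circle.norm_coe, one_mul]
      exact NonUnitalStarAlgHom.norm_apply_le (α g) a

theorem twirl_apply (a : A) : α.twirl χ μ a = ∫ g, (χ g : ℂ) • α g a ∂μ := rfl

theorem twirl_eq_self {a : A} (ha : ∀ g, α g a = ((χ g)⁻¹ : Circle) • a) :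
    α.twirl χ μ a = a := by
  have h : ∀ g, (χ g : ℂ) • α g a = a := fun g => by
    rw [ha, ← Circle.smul_def, smul_smul, mul_inv_cancel, one_smul]
  simp [twirl_apply, h]

end CStarAction

namespace NCTorus

variable {n : ℕ} (θ : Matrix (Fin n) (Fin n) ℝ) [MeasurableSpace (Torus n)] [BorelSpace (Torus n)]
  (μ : Measure (Torus n)) [IsProbabilityMeasure μ] [μ.IsMulLeftInvariant]

/-- Averaging multiplies a word by the integral of its degree character. Invariance of the measure
makes this zero for a nontrivial character; for a trivial one the word is already a scalar. -/
theorem twirl_word_mem_span_one (g : FreeGroup (Fin n)) :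
    (gaugeAction θ).twirl 1 μ (word θ g : NCTorus θ) ∈ Submodule.span ℂ {(1 : NCTorus θ)} := by
  have h1 : (gaugeAction θ).twirl 1 μ (word θ g : NCTorus θ) =
      (∫ t : Torus n, (FreeGroup.lift t g : ℂ) ∂μ) • (word θ g : NCTorus θ) := by
    rw [CStarAction.twirl_apply, ← integral_smul_const]
    congr 1; funext t
    exact (one_smul ℂ _).trans (gaugeHom_word θ t g)
  rw [h1]
  by_cases hg : ∀ t : Torus n, FreeGroup.lift t g = 1
  · obtain ⟨c, hc⟩ := exists_word_eq_smul_one θ hg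
    rw [hc, smul_smul]
    exact Submodule.smul_mem _ _ (Submodule.mem_span_singleton_self _)
  · push Not at hg
    obtain ⟨s, hs⟩ := hg
    have h2 : ∀ t : Torus n, FreeGroup.lift (s * t) g = FreeGroup.lift s g * FreeGroup.lift t g :=
      fun t => DFunLike.congr_fun (FreeGroup.ext_hom (FreeGroup.lift (s * t))
        (FreeGroup.lift s * FreeGroup.lift t) fun j => by simp) g
    have h3 := integral_mul_left_eq_self (μ := μ)
      (fun t : Torus n => (FreeGroup.lift t g : ℂ)) s
    simp only [h2, Circle.coe_mul] at h3
    rw [integral_const_mul] at h3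
    have h4 : (∫ t : Torus n, (FreeGroup.lift t g : ℂ) ∂μ) = 0 := by
      by_contra h0
      exact hs (Circle.ext (mul_right_cancel₀ h0 (h3.trans (one_mul _).symm)))
    rw [h4, zero_smul]
    exact Submodule.zero_mem _

/-- The gauge action on the noncommutative torus is ergodic. -/
theorem twirl_one_mem_span_one (b : NCTorus θ) :
    (gaugeAction θ).twirl 1 μ b ∈ Submodule.span ℂ {(1 : NCTorus θ)} := by
  -- The line `ℂ1` is closed, so it suffices to treat linear combinations of words.
  refine (denseRange_of θ).induction_on b
    ((Submodule.closed_of_finiteDimensional _).preimage (map_continuous _)) fun x => ?_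
  induction x using MonoidAlgebra.induction_linear with
  | zero => rw [map_zero, map_zero]; exact Submodule.zero_mem _
  | add x y hx hy => rw [map_add, map_add]; exact Submodule.add_mem _ hx hy
  | single g c =>
    have h : MonoidAlgebra.single g c = c • MonoidAlgebra.single g (1 : ℂ) := by simp
    rw [h, map_smul, map_smul, of_single_one]
    exact Submodule.smul_mem _ _ (twirl_word_mem_span_one θ μ g)

/-- Multiplication by `star V` shifts degree `χ⁻¹` to the trivial degree: the average of `b` against
`χ` is `V` times the invariant average of `star V * b`, a scalar by ergodicity. -/
theorem exists_twirl_eq_smul {χ : Torus n →ₜ* Circle} {V : NCTorus θ}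
    (hV : V ∈ unitary (NCTorus θ)) (hχ : ∀ t, gaugeAction θ t V = ((χ t)⁻¹ : Circle) • V)
    (b : NCTorus θ) : ∃ c : ℂ, (gaugeAction θ).twirl χ μ b = c • V := by
  obtain ⟨c, hc⟩ := Submodule.mem_span_singleton.1 (twirl_one_mem_span_one θ μ (star V * b))
  refine ⟨c, ?_⟩
  have hb : b = V * (star V * b) := by
    rw [← mul_assoc, (Unitary.mem_iff.1 hV).2, one_mul]
  have h1 : ∀ t, (χ t : ℂ) • gaugeAction θ t b =
      ContinuousLinearMap.mul ℂ (NCTorus θ) V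
        (((1 : Torus n →ₜ* Circle) t : ℂ) • gaugeAction θ t (star V * b)) := fun t => by
    conv_lhs => rw [hb, map_mul, hχ, smul_mul_assoc, ← Circle.smul_def, smul_smul,
      mul_inv_cancel, one_smul]
    exact congrArg (V * ·) (one_smul ℂ _).symm
  rw [CStarAction.twirl_apply]
  simp only [h1]
  rw [ContinuousLinearMap.integral_comp_comm _ ((gaugeAction θ).integrable_smul_apply 1 μ _),
    ← CStarAction.twirl_apply, ← hc]
  simp

end NCTorus

end Twirl

/-! ## Spectral subspaces of the deformation -/

namespace SpatialTensor

variable {A : Type u} [NonUnitalCStarAlgebra A] {N : Type v} [NonUnitalCStarAlgebra N]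

variable (A N) in
/-- The bilinear map `(a, b) ↦ a ⊗ b`. -/
def tmulL : A →L[ℂ] N →L[ℂ] SpatialTensor A N :=
  LinearMap.mkContinuous₂ (LinearMap.mk₂ ℂ (fun a b => tmul a b)
    (fun a a' b => by simp [tmul, TensorProduct.add_tmul])
    (fun c a b => by simp [tmul, ← TensorProduct.smul_tmul'])
    (fun a b b' => by simp [tmul, TensorProduct.tmul_add])
    (fun c a b => by simp [tmul])) 1 fun a b => by rw [one_mul]; exact norm_tmul_le a b

theorem tmulL_apply (a : A) (b : N) : tmulL A N a b = tmul a b := rfl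

theorem tmul_mul_tmul (a a' : A) (b b' : N) : tmul a b * tmul a' b' = tmul (a * a') (b * b') := by
  rw [tmul, tmul, tmul, ← map_mul, Algebra.TensorProduct.tmul_mul_tmul]

theorem star_tmul (a : A) (b : N) : star (tmul a b) = tmul (star a) (star b) := by
  rw [tmul, tmul, ← map_star, TensorProduct.star_tmul]

theorem smul_tmul (c : ℂ) (a : A) (b : N) : tmul (c • a) b = c • tmul a b := by
  rw [← tmulL_apply, map_smul]; rfl

theorem tmul_smul (c : ℂ) (a : A) (b : N) : tmul a (c • b) = c • tmul a b := by
  rw [← tmulL_apply, map_smul]; rfl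

end SpatialTensor

section Deformation

open SpatialTensor MeasureTheory

theorem Torus.exists_invariant_probability (n : ℕ) :
    ∃ (_ : MeasurableSpace (Torus n)) (_ : BorelSpace (Torus n)) (μ : Measure (Torus n)),
      IsProbabilityMeasure μ ∧ μ.IsMulLeftInvariant := by
  let m := borel (Torus n)
  have hm : BorelSpace (Torus n) := ⟨rfl⟩
  -- With the whole compact group as reference set, Haar measure has total mass `1`.
  exact ⟨m, hm, Measure.haarMeasure ⊤, ⟨Measure.haarMeasure_self⟩, inferInstance⟩

variable {A : Type u} [NonUnitalCStarAlgebra A] {n : ℕ} {θ : Matrix (Fin n) (Fin n) ℝ}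

theorem tmul_unitary_injective (hθ : θ.transpose = -θ) {V : NCTorus θ}
    (hV : V ∈ unitary (NCTorus θ)) {a b : A} (h : tmul a V = tmul b V) : a = b := by
  have h1 : tmul (a - b) V = 0 := by
    rw [← tmulL_apply, map_sub]
    exact sub_eq_zero.2 h
  rw [← sub_eq_zero, ← norm_eq_zero, ← NCTorus.norm_tmul_unitary θ hθ _ hV, h1, norm_zero]

/-- An element of the tensor product that is homogeneous in the second factor is an elementary
tensor. -/
theorem exists_eq_tmul_of_homogeneous (hθ : θ.transpose = -θ) {χ : Torus n →ₜ* Circle}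
    {V : NCTorus θ} (hV : V ∈ unitary (NCTorus θ))
    (hχ : ∀ t, NCTorus.gaugeAction θ t V = ((χ t)⁻¹ : Circle) • V)
    {x : SpatialTensor A (NCTorus θ)}
    (hx : ∀ t, (CStarAction.trivial : CStarAction (Torus n) A).diag (NCTorus.gaugeAction θ) t x =
      ((χ t)⁻¹ : Circle) • x) :
    ∃ a : A, x = tmul a V := by
  obtain ⟨_, _, μ, _, _⟩ := Torus.exists_invariant_probability n
  let γ := (CStarAction.trivial : CStarAction (Torus n) A).diag (NCTorus.gaugeAction θ)
  let r : A →ₗᵢ[ℂ] SpatialTensor A (NCTorus θ) :=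
    { toLinearMap := ((tmulL A (NCTorus θ)).flip V : A →ₗ[ℂ] SpatialTensor A (NCTorus θ))
      norm_map' := fun a => NCTorus.norm_tmul_unitary θ hθ a hV }
  -- The range of an isometry from the complete space `A` is closed.
  have hr : IsClosed (r.toLinearMap.range : Set (SpatialTensor A (NCTorus θ))) := by
    rw [LinearMap.coe_range]
    exact r.isometry.isClosedEmbedding.isClosed_range
  -- Averaging acts on the second factor only and sends `a ⊗ b` to `a ⊗ cV = ca ⊗ V`; density and
  -- closedness of the range give all `y`. A homogeneous `x` equals its own average.
  have key : ∀ y, γ.twirl χ μ y ∈ r.toLinearMap.range := fun y => by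
    refine denseRange_of.induction_on y (hr.preimage (map_continuous _)) fun z => ?_
    induction z using TensorProduct.induction_on with
    | zero => rw [map_zero, map_zero]; exact Submodule.zero_mem _
    | add x y hx hy => rw [map_add, map_add]; exact Submodule.add_mem _ hx hy
    | tmul a b =>
      obtain ⟨c, hc⟩ := NCTorus.exists_twirl_eq_smul θ μ hV hχ b
      refine ⟨c • a, ?_⟩
      have h1 : ∀ t, (χ t : ℂ) • γ t (of A (NCTorus θ) (a ⊗ₜ[ℂ] b)) =
          tmulL A (NCTorus θ) a ((χ t : ℂ) • NCTorus.gaugeAction θ t b) := fun t => by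
        rw [map_smul]
        exact congrArg _ (CStarAction.diag_tmul _ _ t a b)
      rw [CStarAction.twirl_apply]
      simp only [h1]
      rw [ContinuousLinearMap.integral_comp_comm _
        ((NCTorus.gaugeAction θ).integrable_smul_apply χ μ _), ← CStarAction.twirl_apply, hc]
      exact (smul_tmul c a V).trans (tmul_smul c a V).symm
  obtain ⟨a, ha⟩ := key x
  exact ⟨a, (γ.twirl_eq_self χ μ hx).symm.trans ha.symm⟩

/-- The diagonal action factors into its two one-sided actions. This lets the degree in the second
factor be deduced from the degree in the first. -/
theorem diag_trivial_diag_apply (α : CStarAction (Torus n) A) (t : Torus n)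
    (x : SpatialTensor A (NCTorus θ)) :
    α.diag CStarAction.trivial t
        ((CStarAction.trivial : CStarAction (Torus n) A).diag (NCTorus.gaugeAction θ) t x) =
      α.diag (NCTorus.gaugeAction θ) t x :=
  DFunLike.congr_fun (SpatialTensor.hom_ext
    (f := (α.diag CStarAction.trivial t).comp
      ((CStarAction.trivial : CStarAction (Torus n) A).diag (NCTorus.gaugeAction θ) t))
    (g := α.diag (NCTorus.gaugeAction θ) t) fun a b => by
      rw [NonUnitalStarAlgHom.comp_apply, CStarAction.diag_tmul, CStarAction.diag_tmul,
        CStarAction.diag_tmul]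
      rfl) x

theorem diag_trivial_apply_inj (α : CStarAction (Torus n) A) (t : Torus n)
    {x y : SpatialTensor A (NCTorus θ)}
    (h : α.diag (CStarAction.trivial : CStarAction (Torus n) (NCTorus θ)) t x =
      α.diag (CStarAction.trivial : CStarAction (Torus n) (NCTorus θ)) t y) : x = y := by
  have := congrArg (α.diag (CStarAction.trivial : CStarAction (Torus n) (NCTorus θ)) t⁻¹) h
  rwa [← CStarAction.mul_apply, ← CStarAction.mul_apply, inv_mul_cancel, CStarAction.one_apply,
    CStarAction.one_apply] at this

/-- The spectral subspaces of the deformation are `(A_θ)_χ = A_χ ⊗ V`, for any unitary `V` of the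
noncommutative torus on which the torus acts by `χ⁻¹`. -/
theorem mem_spectralSubspace_thetaAction_iff (hθ : θ.transpose = -θ) (α : CStarAction (Torus n) A)
    {χ : Torus n →ₜ* Circle} {V : NCTorus θ} (hV : V ∈ unitary (NCTorus θ))
    (hχ : ∀ t, NCTorus.gaugeAction θ t V = ((χ t)⁻¹ : Circle) • V) (x : thetaDeformation α θ) :
    x ∈ (thetaAction α θ).spectralSubspace χ ↔
      ∃ a ∈ α.spectralSubspace χ, (x : SpatialTensor A (NCTorus θ)) = tmul a V := by
  have htriv : ∀ (t : Torus n) (a : A), α.diag (CStarAction.trivial : CStarAction (Torus n) _) t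
      (tmul a V) = tmul (α t a) V := fun t a => CStarAction.diag_tmul _ _ t a V
  constructor
  · intro hx
    have h1 : ∀ t, α.diag (CStarAction.trivial : CStarAction (Torus n) (NCTorus θ)) t x =
        (χ t : ℂ) • (x : SpatialTensor A (NCTorus θ)) := fun t => congrArg Subtype.val (hx t)
    obtain ⟨a, ha⟩ := exists_eq_tmul_of_homogeneous hθ hV hχ
        (x := (x : SpatialTensor A (NCTorus θ))) fun t => by
      -- Apply `α_t ⊗ id` to both sides: the left becomes the diagonal action, which fixes `x`; on
      -- the right its factor `χ t` cancels `(χ t)⁻¹`.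
      refine diag_trivial_apply_inj α t ?_
      have h2 : α.diag (CStarAction.trivial : CStarAction (Torus n) (NCTorus θ)) t
          (((χ t)⁻¹ : Circle) • (x : SpatialTensor A (NCTorus θ))) = x := by
        rw [Circle.smul_def, map_smul, h1, ← Circle.smul_def, ← Circle.smul_def, smul_smul,
          inv_mul_cancel, one_smul]
      exact (diag_trivial_diag_apply α t _).trans ((x.2 t).trans h2.symm)
    refine ⟨a, fun t => tmul_unitary_injective hθ hV ?_, ha⟩
    rw [← htriv, ← ha, h1, smul_tmul, ha]
  · rintro ⟨a, ha, hxa⟩ t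
    refine Subtype.ext ?_
    change α.diag (CStarAction.trivial : CStarAction (Torus n) (NCTorus θ)) t x =
      (χ t : ℂ) • (x : SpatialTensor A (NCTorus θ))
    rw [hxa, htriv, ha t, smul_tmul]

/-- The opposite degrees of `a` and `V` cancel under the diagonal action. -/
theorem tmul_mem_thetaDeformation (α : CStarAction (Torus n) A) {χ : Torus n →ₜ* Circle}
    {V : NCTorus θ} (hχ : ∀ t, NCTorus.gaugeAction θ t V = ((χ t)⁻¹ : Circle) • V) {a : A}
    (ha : a ∈ α.spectralSubspace χ) : tmul a V ∈ thetaDeformation α θ := fun t => by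
  rw [CStarAction.diag_tmul, ha t, hχ t, Circle.smul_def, smul_tmul, tmul_smul, ← Circle.smul_def,
    ← Circle.smul_def, smul_smul, mul_inv_cancel, one_smul]

theorem gaugeAction_one (t : Torus n) :
    NCTorus.gaugeAction θ t 1 = (((1 : Torus n →ₜ* Circle) t)⁻¹ : Circle) • 1 := by
  refine (map_one (NCTorus.gaugeHom θ t)).trans ?_
  change _ = (1 : Circle)⁻¹ • _
  rw [inv_one, one_smul]

theorem mem_fixedPoints_iff {G : Type v} [Group G] [TopologicalSpace G] (α : CStarAction G A)
    (a : A) : a ∈ α.fixedPoints ↔ a ∈ α.spectralSubspace 1 :=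
  forall_congr' fun _ => by
    change _ ↔ _ = (1 : ℂ) • _
    rw [one_smul]

/-- The isomorphism `a ↦ a ⊗ 1` of the fixed point algebras. -/
theorem exists_fixedPoints_equiv (hθ : θ.transpose = -θ) (α : CStarAction (Torus n) A) :
    ∃ ψ : α.fixedPoints ≃⋆ₐ[ℂ] (thetaAction α θ).fixedPoints, ∀ a : α.fixedPoints,
      ((ψ a : thetaDeformation α θ) : SpatialTensor A (NCTorus θ)) =
        tmul (a : A) (1 : NCTorus θ) := by
  have h1 : ∀ a : α.fixedPoints, tmul (a : A) (1 : NCTorus θ) ∈ thetaDeformation α θ := fun a =>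
    tmul_mem_thetaDeformation α gaugeAction_one ((mem_fixedPoints_iff α a).1 a.2)
  have h2 : ∀ a : α.fixedPoints, (⟨_, h1 a⟩ : thetaDeformation α θ) ∈
      (thetaAction α θ).fixedPoints := fun a => (mem_fixedPoints_iff _ _).2
    ((mem_spectralSubspace_thetaAction_iff hθ α (one_mem _) gaugeAction_one _).2
      ⟨a, (mem_fixedPoints_iff α a).1 a.2, rfl⟩)
  let φ : α.fixedPoints →⋆ₙₐ[ℂ] (thetaAction α θ).fixedPoints :=
    { toFun := fun a => ⟨⟨_, h1 a⟩, h2 a⟩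
      map_smul' := fun c a => Subtype.ext (Subtype.ext (smul_tmul c (a : A) 1))
      map_zero' := Subtype.ext (Subtype.ext
        (congrArg (fun f : NCTorus θ →L[ℂ] _ => f 1) (map_zero (tmulL A (NCTorus θ)))))
      map_add' := fun a b => Subtype.ext (Subtype.ext
        (congrArg (fun f : NCTorus θ →L[ℂ] _ => f 1) (map_add (tmulL A (NCTorus θ)) (a : A) b)))
      map_mul' := fun a b => Subtype.ext (Subtype.ext
        ((tmul_mul_tmul (a : A) b (1 : NCTorus θ) 1).trans
          (congrArg (tmul ((a : A) * b)) (one_mul _))).symm)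
      map_star' := fun a => Subtype.ext (Subtype.ext
        ((star_tmul (a : A) (1 : NCTorus θ)).trans
          (congrArg (tmul (star (a : A))) (star_one _))).symm) }
  refine ⟨StarAlgEquiv.ofBijective φ ⟨fun a b hab => ?_, fun x => ?_⟩, fun a => rfl⟩
  · exact Subtype.ext (tmul_unitary_injective hθ (one_mem _)
      (congrArg (fun z : (thetaAction α θ).fixedPoints => ((z : thetaDeformation α θ) :
        SpatialTensor A (NCTorus θ))) hab))
  -- Surjectivity is the description of the spectral subspaces for `χ = 1`, `V = 1`.
  · obtain ⟨a, ha, hxa⟩ := (mem_spectralSubspace_thetaAction_iff hθ α (one_mem _) gaugeAction_one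
      _).1 ((mem_fixedPoints_iff _ _).1 x.2)
    exact ⟨⟨a, (mem_fixedPoints_iff α a).2 ha⟩, Subtype.ext (Subtype.ext hxa.symm)⟩

end Deformation

/-! ## Transport of complemented ideals -/

section Transport

variable {B : Type u} [NonUnitalCStarAlgebra B] {B' : Type v} [NonUnitalCStarAlgebra B']

/-- A `*`-isomorphism of C*-algebras as a linear isometric equivalence. -/
def StarAlgEquiv.toLinearIsometryEquivOfCStar (ψ : B ≃⋆ₐ[ℂ] B') : B ≃ₗᵢ[ℂ] B' where
  toFun := ψ
  invFun := ψ.symm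
  map_add' := map_add ψ
  map_smul' := map_smul ψ
  left_inv := ψ.left_inv
  right_inv := ψ.right_inv
  norm_map' := StarAlgEquiv.norm_map ψ

theorem IsClosedIdeal.map {I : Submodule ℂ B} (hI : IsClosedIdeal I) (ψ : B ≃⋆ₐ[ℂ] B') :
    IsClosedIdeal (I.map (ψ.toLinearIsometryEquivOfCStar.toLinearEquiv : B →ₗ[ℂ] B')) := by
  refine ⟨?_, ?_⟩
  · rw [Submodule.map_coe]
    exact ψ.toLinearIsometryEquivOfCStar.toHomeomorph.isClosedMap _ hI.1
  · rintro _ ⟨x, hx, rfl⟩ b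
    obtain ⟨b, rfl⟩ := ψ.surjective b
    exact ⟨⟨b * x, (hI.2 x hx b).1, map_mul ψ b x⟩, ⟨x * b, (hI.2 x hx b).2, map_mul ψ x b⟩⟩

/-- A `*`-isomorphism is isometric, so it preserves closed ideals, and it induces a lattice
isomorphism of subspaces, so it preserves complements. -/
theorem IsComplementedIdeal.of_image_eq {I : Submodule ℂ B} (hI : IsComplementedIdeal I)
    (ψ : B ≃⋆ₐ[ℂ] B') {I' : Submodule ℂ B'} (h : ψ '' (I : Set B) = I') :
    IsComplementedIdeal I' := by
  obtain ⟨h1, J, hJ, hIJ⟩ := hI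
  obtain rfl : I.map (ψ.toLinearIsometryEquivOfCStar.toLinearEquiv : B →ₗ[ℂ] B') = I' :=
    SetLike.coe_injective h
  exact ⟨h1.map ψ, _, hJ.map ψ, (OrderIso.isCompl_iff (Submodule.orderIsoMapComap
    ψ.toLinearIsometryEquivOfCStar.toLinearEquiv)).1 hIJ⟩

theorem isComplementedIdeal_iff_of_image_eq (ψ : B ≃⋆ₐ[ℂ] B') {I : Submodule ℂ B}
    {I' : Submodule ℂ B'} (h : ψ '' (I : Set B) = I') :
    IsComplementedIdeal I' ↔ IsComplementedIdeal I :=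
  ⟨fun hI => hI.of_image_eq ψ.symm (by rw [← h, Set.image_image]; simp),
    fun hI => hI.of_image_eq ψ h⟩

theorem StarAlgEquiv.image_topologicalClosure_span (ψ : B ≃⋆ₐ[ℂ] B') (S : Set B) :
    ψ '' ((Submodule.span ℂ S).topologicalClosure : Set B) =
      ((Submodule.span ℂ (ψ '' S)).topologicalClosure : Set B') := by
  rw [Submodule.topologicalClosure_coe, Submodule.topologicalClosure_coe]
  refine (ψ.toLinearIsometryEquivOfCStar.toHomeomorph.image_closure _).trans ?_
  congr 1
  exact congrArg SetLike.coe (Submodule.map_span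
    (ψ.toLinearIsometryEquivOfCStar.toLinearEquiv : B →ₗ[ℂ] B') S)

end Transport

/-! ### Comparison of the spectral ideals -/

set_option maxHeartbeats 1000000 in
-- The reason is the cancellation `(a ⊗ V)(b ⊗ V)⋆ = ab⋆ ⊗ VV⋆ = ab⋆ ⊗ 1`. Generators are matched
-- before taking spans and closures.
theorem image_generators_spectralIdeal {A : Type u} [NonUnitalCStarAlgebra A] {n : ℕ}
    {θ : Matrix (Fin n) (Fin n) ℝ} (hθ : θ.transpose = -θ) (α : CStarAction (Torus n) A)
    (ψ : α.fixedPoints ≃⋆ₐ[ℂ] (thetaAction α θ).fixedPoints)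
    (hψ : ∀ a : α.fixedPoints, ((ψ a : thetaDeformation α θ) : SpatialTensor A (NCTorus θ)) =
      SpatialTensor.tmul (a : A) (1 : NCTorus θ)) (χ : Torus n →ₜ* Circle) :
    ψ '' {x : α.fixedPoints | ∃ a ∈ α.spectralSubspace χ, ∃ b ∈ α.spectralSubspace χ,
      (x : A) = a * star b} =
    {x : (thetaAction α θ).fixedPoints | ∃ a ∈ (thetaAction α θ).spectralSubspace χ,
      ∃ b ∈ (thetaAction α θ).spectralSubspace χ, (x : thetaDeformation α θ) = a * star b} := by
  -- The inverse character is used because `V` must compensate the degree `χ` of the first factor.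
  obtain ⟨V, hV, hχ⟩ := NCTorus.exists_unitary_gauge θ χ⁻¹
  replace hχ : ∀ t, NCTorus.gaugeAction θ t V = ((χ t)⁻¹ : Circle) • V := hχ
  have hmul : ∀ a b : A, SpatialTensor.tmul a V * star (SpatialTensor.tmul b V) =
      SpatialTensor.tmul (a * star b) (1 : NCTorus θ) := fun a b => by
    rw [SpatialTensor.star_tmul, SpatialTensor.tmul_mul_tmul, (Unitary.mem_iff.1 hV).2]
  refine Set.Subset.antisymm ?_ fun y => ?_
  · rintro _ ⟨x, ⟨a, ha, b, hb, hx⟩, rfl⟩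
    refine ⟨⟨_, tmul_mem_thetaDeformation α hχ ha⟩,
      (mem_spectralSubspace_thetaAction_iff hθ α hV hχ _).2 ⟨a, ha, rfl⟩,
      ⟨_, tmul_mem_thetaDeformation α hχ hb⟩,
      (mem_spectralSubspace_thetaAction_iff hθ α hV hχ _).2 ⟨b, hb, rfl⟩, Subtype.ext ?_⟩
    rw [hψ, hx]
    exact (hmul a b).symm
  · rintro ⟨x, hx, z, hz, hy⟩
    obtain ⟨a, ha, hxa⟩ := (mem_spectralSubspace_thetaAction_iff hθ α hV hχ _).1 hx
    obtain ⟨b, hb, hzb⟩ := (mem_spectralSubspace_thetaAction_iff hθ α hV hχ _).1 hz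
    obtain ⟨w, rfl⟩ := EquivLike.surjective ψ y
    refine ⟨w, ⟨a, ha, b, hb, tmul_unitary_injective hθ (one_mem _) ?_⟩, rfl⟩
    rw [← hψ, ← hmul, ← hxa, ← hzb]
    exact congrArg Subtype.val hy

end

set_option maxHeartbeats 1000000 in
theorem mainTheorem11 {A : Type*} [NonUnitalCStarAlgebra A] (n : ℕ)
    (α : CStarAction (Torus n) A) (θ : Matrix (Fin n) (Fin n) ℝ) (hθ : θ.transpose = -θ) :
    ((thetaAction α θ).SpectralSubspaceAssumption ↔ α.SpectralSubspaceAssumption) ∧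
    ∃ ψ : α.fixedPoints ≃⋆ₐ[ℂ] (thetaAction α θ).fixedPoints,
      (∀ a : α.fixedPoints,
        ((ψ a : thetaDeformation α θ) : SpatialTensor A (NCTorus θ)) =
          SpatialTensor.tmul (a : A) (1 : NCTorus θ)) ∧
      ∀ χ : Torus n →ₜ* Circle,
        ψ '' (α.spectralIdeal χ : Set α.fixedPoints) =
          ((thetaAction α θ).spectralIdeal χ : Set (thetaAction α θ).fixedPoints) := by
  obtain ⟨ψ, hψ⟩ := exists_fixedPoints_equiv hθ α
  have himage : ∀ χ : Torus n →ₜ* Circle, ψ '' (α.spectralIdeal χ : Set α.fixedPoints) =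
      ((thetaAction α θ).spectralIdeal χ : Set (thetaAction α θ).fixedPoints) := fun χ => by
    refine (ψ.image_topologicalClosure_span _).trans ?_
    rw [image_generators_spectralIdeal hθ α ψ hψ χ]
    rfl
  -- The same `ψ` serves all characters, so the two assumptions are equivalent character by
  -- character.
  exact ⟨forall_congr' fun χ => isComplementedIdeal_iff_of_image_eq ψ (himage χ), ψ, hψ, himage⟩
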